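/- Let $d\ge 1$ be an integer, $\alpha>0$, $t\in[1,2]$, $\eta\in(0,1)$, $\delta>0$ and $c_\star\in(0,\tfrac12)$, and let $\|\cdot\|$ be the Euclidean norm on $\mathbb R^d$. **Class of densities.** Put $m=\lceil\alpha\rceil-1$. For $L>0$ let $H(\alpha,L)$ be the set of functions $p:\mathbb R^d\to\mathbb R$ that are $m$ times differentiable and satisfy $|p(y)-P_p(x,y-x)|\le L\|x-y\|^\alpha$ for all $x,y\in\mathbb R^d$, where $z\mapsto P_p(x,z)$ is the Taylor polynomial of degree $m$ of $p$ at $x$. Let $\mathcal P(\alpha,L,c_\star)$ be the set of $p\in H(\alpha,L)$ with $p\ge 0$, $\int_{\mathbb R^d}p=1$ and $|p(x)-p(y)|\le c_\star\,p(x)+L\|x-y\|^\alpha$ for all $x,y\in\mathbb R^d$. **Testing problem.** Let $n\ge1$ be an integer and $p_0\in\mathcal P(\alpha,L,c_\star)$. For a density $p$ let $\mathbb P_p$ be the law of $n$ i.i.d. observations with density $p$. For $\rho>0$ put $$\mathcal P_1(\rho,t)=\big\{p\in\mathcal P(\alpha,(1+\delta)L,(1+\delta)c_\star):\ \|p-p_0\|_t\ge\rho\big\},\qquad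 R^*(\rho)=\inf_\psi\Big\{\mathbb P_{p_0}(\psi=1)+\sup_{p\in\mathcal P_1(\rho,t)}\mathbb P_p(\psi=0)\Big\},$$ where $\|\cdot\|_t$ is the norm of $L_t(\mathbb R^d)$ for Lebesgue measure and the infimum is over all measurable tests $\psi:(\mathbb R^d)^n\to\{0,1\}$ (a supremum over the empty set being $0$). The minimax separation radius is $\rho^*=\inf\{\rho>0:R^*(\rho)\le\eta\}$. **Bulk and tail.** Let $c_{aux},c_B>0$. Write $f[A]=\int_A f$ for a nonnegative function $f$, and $\mathcal B(u)=\{x:p_0(x)\ge u\}$, $\mathcal T(u)=\{x:p_0(x)<u\}$ for $u\in[0,\infty]$. Put $\widetilde L=L^d/n^{2\alpha}$, $r=\frac{2\alpha t}{(4-t)\alpha+d}$, $$u_{aux}=\sup\Big\{0\le u<\infty:\ \frac{p_0^2[\mathcal T(u)]}{(p_0[\mathcal T(u)])^{d/(\alpha+d)}}\le c_{aux}\,\widetilde L^{1/(\alpha+d)}\Big\}\in[0,\infty]$$ (the quotient is read as $0$ when $\mathcal T(u)=\emptyset$), $\mathcal I=p_0^r[\mathcal B(u_{aux})]$, $$u_B=u_{aux}\vee\Big[c_B\,\frac{L^{d/(4\alpha+d)}}{(n^2\mathcal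 I)^{\alpha/(4\alpha+d)}}\Big]^{\frac{(4-t)\alpha+d}{(2-t)\alpha+d}}$$ ($u_B=\infty$ if $\mathcal I=0$), and $$\rho^*_{bulk}=\Big[\widetilde L\,\big\|p_0\mathbf 1_{\mathcal B(u_{aux})}\big\|_r^{2\alpha}\Big]^{\frac1{4\alpha+d}},\qquad \rho^*_{tail}=\Big[\widetilde L^{\,t-1}\,p_0[\mathcal T(u_B)]^{(2-t)\alpha+d}\Big]^{\frac1{t(\alpha+d)}},$$ where $\|f\|_r=(\int|f|^r)^{1/r}$ also when $r<1$. **Proposition.** For all $c_{aux},c_B,C_{BT}>0$ there is a constant $C^{LB}_{bulk}>0$, depending only on $d,\alpha,t,\eta,\delta,c_\star,c_{aux},c_B,C_{BT}$, such that for every $L>0$, every $n\ge1$ and every $p_0\in\mathcal P(\alpha,L,c_\star)$: if the bulk dominates, that is, if $C_{BT}\,\rho^*_{bulk}\ge\rho^*_{tail}$, then $$\rho^*\ \ge\ C^{LB}_{bulk}\;\rho^*_{bulk}.$$ -/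

import Mathlib

open MeasureTheory Set
open scoped ENNReal NNReal

noncomputable section

namespace HolderGoF

/-- The observation space `ℝ^d` with the Euclidean norm and Lebesgue measure. -/
abbrev Space (d : ℕ) : Type := EuclideanSpace ℝ (Fin d)

/-! ### The class of densities -/

/-- `m = ⌈α⌉ - 1`, the number of derivatives (for `α > 0` the ceiling is at least `1`). -/
def smoothOrder (α : ℝ) : ℕ := ⌈α⌉₊ - 1

/-- The Taylor polynomial `z ↦ P_p(x, z)` of degree `m` of `p` at `x`, in the increment `z`. -/
def taylorPoly {d : ℕ} (m : ℕ) (p : Space d → ℝ) (x z : Space d) : ℝ :=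
  ∑ k ∈ Finset.range (m + 1), ((k.factorial : ℝ))⁻¹ * iteratedFDeriv ℝ k p x (fun _ => z)

/-- The Hölder class `H(α, L)` over `ℝ^d`: `p` is `m` times differentiable, and its Taylor
polynomial of degree `m` at `x` approximates `p y` up to `L ‖x - y‖ ^ α`. -/
def holderClass (d : ℕ) (α L : ℝ) : Set (Space d → ℝ) :=
  {p | (∀ k < smoothOrder α, Differentiable ℝ (iteratedFDeriv ℝ k p)) ∧
    ∀ x y : Space d, |p y - taylorPoly (smoothOrder α) p x (y - x)| ≤ L * ‖x - y‖ ^ α}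

/-- The class `P(α, L, cstar)` of probability densities in `H(α, L)` that satisfy
`|p x - p y| ≤ cstar * p x + L ‖x - y‖ ^ α`. (The equation `∫ p = 1` forces integrability.) -/
def densityClass (d : ℕ) (α L cstar : ℝ) : Set (Space d → ℝ) :=
  {p | p ∈ holderClass d α L ∧ (∫ x, p x) = 1 ∧ (∀ x, 0 ≤ p x) ∧
    ∀ x y : Space d, |p x - p y| ≤ cstar * p x + L * ‖x - y‖ ^ α}

/-! ### The minimax testing framework -/

/-- The law `ℙ_p` of `n` independent observations with density `p`. -/
def sampleLaw {d : ℕ} (n : ℕ) (p : Space d → ℝ) : Measure (Fin n → Space d) :=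
  Measure.pi fun _ => (volume : Measure (Space d)).withDensity fun x => ENNReal.ofReal (p x)

/-- The alternative: all `p` in `P(α, (1+δ)L, (1+δ)cstar)` with `‖p - p₀‖_t ≥ ρ`. -/
def alternative {d : ℕ} (α L cstar δ t : ℝ) (p₀ : Space d → ℝ) (ρ : ℝ) : Set (Space d → ℝ) :=
  {p | p ∈ densityClass d α ((1 + δ) * L) ((1 + δ) * cstar) ∧
    ENNReal.ofReal ρ ≤ eLpNorm (fun x => p x - p₀ x) (ENNReal.ofReal t) volume}

/-- The risk of a test: type-I error plus worst type-II error over the alternative. -/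
def risk {d : ℕ} (α L cstar δ t : ℝ) (n : ℕ) (p₀ : Space d → ℝ) (ρ : ℝ)
    (ψ : (Fin n → Space d) → Fin 2) : ℝ≥0∞ :=
  sampleLaw n p₀ {X | ψ X = 1} +
    ⨆ p ∈ alternative α L cstar δ t p₀ ρ, sampleLaw n p {X | ψ X = 0}

/-- The minimax risk: infimum of the risk over all (measurable) tests. -/
def minimaxRisk {d : ℕ} (α L cstar δ t : ℝ) (n : ℕ) (p₀ : Space d → ℝ) (ρ : ℝ) : ℝ≥0∞ :=
  ⨅ (ψ : (Fin n → Space d) → Fin 2) (_ : Measurable ψ), risk α L cstar δ t n p₀ ρ ψ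

/-- The minimax separation radius `ρ* = inf {ρ > 0 : R*(ρ) ≤ η}`. -/
def separationRadius {d : ℕ} (α L cstar δ t η : ℝ) (n : ℕ) (p₀ : Space d → ℝ) : ℝ≥0∞ :=
  ⨅ (ρ : ℝ) (_ : 0 < ρ ∧ minimaxRisk α L cstar δ t n p₀ ρ ≤ ENNReal.ofReal η), ENNReal.ofReal ρ

/-! ### Bulk, tail and the cut-offs

Cut-offs take values in `[0, ∞]`: the supremum that defines `uAux` is infinite for very
spread-out densities, and then the bulk is empty and the tail is the whole space. -/

/-- `f[A] = ∫_A f` for a nonnegative function `f`. -/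
def mass {d : ℕ} (f : Space d → ℝ) (A : Set (Space d)) : ℝ≥0∞ :=
  ∫⁻ x in A, ENNReal.ofReal (f x)

/-- `B(u) = {x : p₀ x ≥ u}`. -/
def bulk {d : ℕ} (p₀ : Space d → ℝ) (u : ℝ≥0∞) : Set (Space d) :=
  {x | u ≤ ENNReal.ofReal (p₀ x)}

/-- `T(u) = {x : p₀ x < u}`. -/
def tail {d : ℕ} (p₀ : Space d → ℝ) (u : ℝ≥0∞) : Set (Space d) :=
  {x | ENNReal.ofReal (p₀ x) < u}

/-- `L̃ = L ^ d / n ^ (2 α)`. -/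
def Ltilde (d : ℕ) (α L : ℝ) (n : ℕ) : ℝ := L ^ d / (n : ℝ) ^ (2 * α)

/-- `r = 2 α t / ((4 - t) α + d)`. -/
def rExp (d : ℕ) (α t : ℝ) : ℝ := 2 * α * t / ((4 - t) * α + d)

/-- The auxiliary cut-off: the supremum of the finite `u ≥ 0` with
`p₀²[T(u)] / p₀[T(u)] ^ (d / (α + d)) ≤ cAux * L̃ ^ (1 / (α + d))`
(the quotient is `0` where `T(u)` is empty). -/
def uAux {d : ℕ} (α L cAux : ℝ) (n : ℕ) (p₀ : Space d → ℝ) : ℝ≥0∞ :=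
  ⨆ (u : ℝ≥0) (_ : mass (fun x => p₀ x ^ 2) (tail p₀ u) / mass p₀ (tail p₀ u) ^ ((d : ℝ) / (α + d))
      ≤ ENNReal.ofReal (cAux * Ltilde d α L n ^ (1 / (α + d)))), (u : ℝ≥0∞)

/-- `I = ∫_{B(uAux)} p₀ ^ r`. -/
def bulkIntegral {d : ℕ} (α L t cAux : ℝ) (n : ℕ) (p₀ : Space d → ℝ) : ℝ≥0∞ :=
  mass (fun x => p₀ x ^ rExp d α t) (bulk p₀ (uAux α L cAux n p₀))

/-- The cut-off `u_B` between bulk and tail. -/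
def uB {d : ℕ} (α L t cAux cB : ℝ) (n : ℕ) (p₀ : Space d → ℝ) : ℝ≥0∞ :=
  max (uAux α L cAux n p₀)
    ((ENNReal.ofReal (cB * L ^ ((d : ℝ) / (4 * α + d))) /
        ((n : ℝ≥0∞) ^ 2 * bulkIntegral α L t cAux n p₀) ^ (α / (4 * α + d)))
      ^ (((4 - t) * α + d) / ((2 - t) * α + d)))

/-- `ρ*_bulk = [L̃ ‖p₀ 1_{B(uAux)}‖_r ^ (2 α)] ^ (1 / (4 α + d))`. -/
def rhoBulk {d : ℕ} (α L t cAux : ℝ) (n : ℕ) (p₀ : Space d → ℝ) : ℝ≥0∞ :=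
  (ENNReal.ofReal (Ltilde d α L n) *
      eLpNorm ((bulk p₀ (uAux α L cAux n p₀)).indicator p₀)
        (ENNReal.ofReal (rExp d α t)) volume ^ (2 * α))
    ^ (1 / (4 * α + d))

/-- `ρ*_tail = [L̃ ^ (t - 1) p₀[T(u_B)] ^ ((2 - t) α + d)] ^ (1 / (t (α + d)))`. -/
def rhoTail {d : ℕ} (α L t cAux cB : ℝ) (n : ℕ) (p₀ : Space d → ℝ) : ℝ≥0∞ :=
  (ENNReal.ofReal (Ltilde d α L n ^ (t - 1)) *
      mass p₀ (tail p₀ (uB α L t cAux cB n p₀)) ^ ((2 - t) * α + d))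
    ^ (1 / (t * (α + d)))

/-- The bulk dominates over the tail: `C_BT ρ*_bulk ≥ ρ*_tail`. -/
def BulkDominates {d : ℕ} (α L t cAux cB CBT : ℝ) (n : ℕ) (p₀ : Space d → ℝ) : Prop :=
  rhoTail α L t cAux cB n p₀ ≤ ENNReal.ofReal CBT * rhoBulk α L t cAux n p₀

end HolderGoF

end

/-!
The lower bound is proved by Le Cam's method with a mixture over random signs. Disjoint balls
`B(xⱼ, hⱼ)` are centred in the bulk `B(uAux)`, a smooth bump `φⱼ` of integral zero and amplitude
proportional to `L hⱼ ^ α` is placed in each, and `p₀` is tested against the uniform mixture of the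
densities `p₀ + ∑ ±φⱼ`.

* The bumps have integral zero and disjoint supports, so the second moment of the likelihood ratio
  of the mixture is at most `exp (n² ∑ (∫ φⱼ² / p₀)² / 2)` (`exists_sgn_le_measureReal`,
  `le_minimaxRisk`). If the exponent is small, no test has small risk.
* Each `p₀ + ∑ ±φⱼ` lies in the slightly larger class. The Hölder remainder of the sum is at most
  twice that of one bump (`abs_sum_rescale_sub_taylorPoly_le`), and the condition on increments
  needs only `∑ |φⱼ| ≤ ε p₀` (`add_mem_densityClass`).
* The bandwidth `h = κ p₀ ^ (2 / ((4 - t) α + d))` maximizes the `L_t` distance for a given cost.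
  With `κ` of order `(n² L⁴ I) ^ (-1 / (4α + d))`, where `I` is the integral of `p₀ ^ r` over the
  bulk, both cost and distance are expressed by `∑ p₀(xⱼ) ^ r hⱼ ^ d`, which by Vitali's covering
  lemma is at least a constant times `I` (`exists_finset_disjoint_closedBall`). The resulting
  distance is of the order of `rhoBulk` (`le_minimaxRisk_of_le_bumpScale`, `rhoBulk_eq_bumpScale`).
* The bumps have to be small compared with `p₀` on all of `B(uAux)`, which amounts to
  `uAux ≥ k uB` for a constant `k`. This is where the dominance of the bulk enters. For `u > uAux`
  the inequality that defines `uAux` is reversed, and `p₀²[T(u)] ≤ u p₀[T(u)]`; hence `uAux` is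
  bounded below by a power of the mass of the tail `T(uB)` (`le_uAux_mul_rpow`), and the dominance
  bounds this mass from above. The exponents match exactly (`exists_mul_bumpScale_le_uAux`).
-/

namespace HolderGoF

/-! ### Taylor remainders and the Hölder class -/

lemma smoothOrder_lt {α : ℝ} (hα : 0 < α) : (smoothOrder α : ℝ) < α := by
  have h1 : 1 ≤ ⌈α⌉₊ := Nat.one_le_ceil_iff.2 hα
  have h2 := Nat.ceil_lt_add_one hα.le
  rw [smoothOrder, Nat.cast_sub h1]
  push_cast
  linarith

lemma le_smoothOrder_add_one {α : ℝ} (hα : 0 < α) : α ≤ (smoothOrder α : ℝ) + 1 := by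
  have h1 : 1 ≤ ⌈α⌉₊ := Nat.one_le_ceil_iff.2 hα
  have h2 := Nat.le_ceil α
  rw [smoothOrder, Nat.cast_sub h1]
  push_cast
  linarith

/-- A smooth compactly supported function lies in the Hölder class of every order: at distances
at most `1` this is Taylor's theorem with one more derivative than the polynomial uses, at larger
distances every term is bounded by a multiple of `‖x - y‖ ^ α`. -/
lemma exists_taylorPoly_remainder_le {d : ℕ} {α : ℝ} (hα : 0 < α) {φ : Space d → ℝ}
    (hφ : ContDiff ℝ (⊤ : ℕ∞) φ) (hc : HasCompactSupport φ) :
    ∃ K : ℝ, 0 < K ∧ ∀ x y : Space d,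
      |φ y - taylorPoly (smoothOrder α) φ x (y - x)| ≤ K * ‖x - y‖ ^ α := by
  set m := smoothOrder α with hm
  have hbd : ∀ k : ℕ, ∃ C : ℝ, ∀ x, ‖iteratedFDeriv ℝ k φ x‖ ≤ C := fun k =>
    (hφ.continuous_iteratedFDeriv (by exact_mod_cast le_top)).bounded_above_of_compact_support
      (hc.iteratedFDeriv k)
  choose C hC using hbd
  have hC0 : ∀ k, 0 ≤ C k := fun k => (norm_nonneg _).trans (hC k 0)
  have hev : ∀ k x z, |iteratedFDeriv ℝ k φ x (fun _ => z)| ≤ C k * ‖z‖ ^ k := by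
    intro k x z
    have := (iteratedFDeriv ℝ k φ x).le_opNorm (fun _ => z)
    rw [Finset.prod_const, Finset.card_univ, Fintype.card_fin, Real.norm_eq_abs] at this
    exact this.trans (by gcongr; exact hC k x)
  have hfac : ∀ k : ℕ, ((k.factorial : ℝ))⁻¹ ≤ 1 := fun k =>
    inv_le_one_of_one_le₀ (by exact_mod_cast Nat.one_le_iff_ne_zero.2 k.factorial_ne_zero)
  refine ⟨C (m + 1) + C 0 + ∑ k ∈ Finset.range (m + 1), C k + 1,
    by
      have := hC0 (m + 1)
      have := hC0 0
      have := Finset.sum_nonneg fun k (_ : k ∈ Finset.range (m + 1)) => hC0 k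
      linarith, fun x y => ?_⟩
  have hsum0 : 0 ≤ ∑ k ∈ Finset.range (m + 1), C k := Finset.sum_nonneg fun k _ => hC0 k
  rw [norm_sub_rev x y]
  set z := y - x with hz
  have hpow0 : 0 ≤ ‖z‖ ^ α := Real.rpow_nonneg (norm_nonneg _) _
  rcases le_total ‖z‖ 1 with h1 | h1
  · have hT := map_add_eq_sum_add_integral_iteratedFDeriv (f := φ) (x := x) (y := z) (n := m)
      (fun t _ => (hφ.contDiffAt).of_le (by exact_mod_cast le_top))
    have hy : x + z = y := by simp [hz]
    rw [hy] at hT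
    have hE : φ y - taylorPoly m φ x z = (m.factorial : ℝ)⁻¹ *
        ∫ t in (0 : ℝ)..1, (1 - t) ^ m • iteratedFDeriv ℝ (m + 1) φ (x + t • z) (fun _ => z) := by
      rw [hT, taylorPoly]
      simp only [smul_eq_mul]
      ring
    rw [hE, abs_mul, abs_of_nonneg (by positivity)]
    have hI : ‖∫ t in (0 : ℝ)..1,
        (1 - t) ^ m • iteratedFDeriv ℝ (m + 1) φ (x + t • z) (fun _ => z)‖
        ≤ C (m + 1) * ‖z‖ ^ (m + 1) * |1 - 0| := by
      refine intervalIntegral.norm_integral_le_of_norm_le_const fun t ht => ?_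
      rw [uIoc_of_le zero_le_one] at ht
      rw [norm_smul, norm_pow, Real.norm_eq_abs, abs_of_nonneg (by linarith [ht.2])]
      calc (1 - t) ^ m * ‖iteratedFDeriv ℝ (m + 1) φ (x + t • z) fun _ => z‖
          ≤ 1 * (C (m + 1) * ‖z‖ ^ (m + 1)) := by
            gcongr
            · exact pow_le_one₀ (by linarith [ht.2]) (by linarith [ht.1])
            · exact hev _ _ _
        _ = _ := one_mul _
    rw [Real.norm_eq_abs, sub_zero, abs_one, mul_one] at hI
    have hp : ‖z‖ ^ (m + 1) ≤ ‖z‖ ^ α := by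
      rw [← Real.rpow_natCast]
      rcases (norm_nonneg z).eq_or_lt with h0 | h0
      · rw [← h0, Real.zero_rpow (by positivity), Real.zero_rpow hα.ne']
      · refine Real.rpow_le_rpow_of_exponent_ge h0 h1 ?_
        push_cast
        exact le_smoothOrder_add_one hα
    calc (m.factorial : ℝ)⁻¹ * _ ≤ 1 * (C (m + 1) * ‖z‖ ^ α) := by
          gcongr
          · exact hfac m
          · exact hI.trans (by gcongr; exact hC0 _)
      _ ≤ _ := by
          rw [one_mul]
          gcongr
          linarith [hC0 0]
  · have hp : ∀ k ∈ Finset.range (m + 1), ‖z‖ ^ k ≤ ‖z‖ ^ α := by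
      intro k hk
      rw [← Real.rpow_natCast]
      refine Real.rpow_le_rpow_of_exponent_le h1 ?_
      have : (k : ℝ) ≤ m := by exact_mod_cast Nat.lt_succ_iff.1 (Finset.mem_range.1 hk)
      exact this.trans (smoothOrder_lt hα).le
    have hφy : |φ y| ≤ C 0 * ‖z‖ ^ α := by
      have h0 := hev 0 y 0
      simp only [iteratedFDeriv_zero_apply, pow_zero, mul_one] at h0
      have h1' : 1 ≤ ‖z‖ ^ α := Real.one_le_rpow h1 hα.le
      nlinarith [hC0 0]
    have hTz : |taylorPoly m φ x z| ≤ (∑ k ∈ Finset.range (m + 1), C k) * ‖z‖ ^ α := by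
      rw [taylorPoly, Finset.sum_mul]
      refine (Finset.abs_sum_le_sum_abs _ _).trans (Finset.sum_le_sum fun k hk => ?_)
      rw [abs_mul, abs_of_nonneg (by positivity)]
      calc ((k.factorial : ℝ))⁻¹ * |iteratedFDeriv ℝ k φ x fun _ => z|
          ≤ 1 * (C k * ‖z‖ ^ α) := by
            gcongr
            · exact hfac k
            · exact (hev k x z).trans (by gcongr; exacts [hC0 k, hp k hk])
        _ = _ := one_mul _
    calc |φ y - taylorPoly m φ x z| ≤ |φ y| + |taylorPoly m φ x z| := abs_sub _ _
      _ ≤ C 0 * ‖z‖ ^ α + (∑ k ∈ Finset.range (m + 1), C k) * ‖z‖ ^ α := add_le_add hφy hTz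
      _ ≤ _ := by
          rw [← add_mul]
          exact mul_le_mul_of_nonneg_right (by linarith [hC0 (m + 1)]) hpow0

/-- Iterated derivatives are additive under the differentiability that the Hölder class
provides: the derivative of top order is not assumed continuous. -/
lemma iteratedFDeriv_add_of_differentiable {d m : ℕ} {f g : Space d → ℝ}
    (hf : ∀ k < m, Differentiable ℝ (iteratedFDeriv ℝ k f))
    (hg : ∀ k < m, Differentiable ℝ (iteratedFDeriv ℝ k g)) :
    ∀ k ≤ m, iteratedFDeriv ℝ k (fun x => f x + g x)
      = fun x => iteratedFDeriv ℝ k f x + iteratedFDeriv ℝ k g x := by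
  intro k
  induction k with
  | zero => intro _; ext; simp
  | succ k ih =>
    intro hk
    have hfk := hf k (by omega)
    have hgk := hg k (by omega)
    ext x v
    rw [add_apply, iteratedFDeriv_succ_apply_left,
      iteratedFDeriv_succ_apply_left, iteratedFDeriv_succ_apply_left, ih (by omega),
      fderiv_fun_add hfk.differentiableAt hgk.differentiableAt]
    simp

lemma taylorPoly_add {d m : ℕ} {f g : Space d → ℝ}
    (hf : ∀ k < m, Differentiable ℝ (iteratedFDeriv ℝ k f))
    (hg : ∀ k < m, Differentiable ℝ (iteratedFDeriv ℝ k g)) (x z : Space d) :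
    taylorPoly m (fun x => f x + g x) x z = taylorPoly m f x z + taylorPoly m g x z := by
  simp only [taylorPoly, ← Finset.sum_add_distrib]
  refine Finset.sum_congr rfl fun k hk => ?_
  rw [iteratedFDeriv_add_of_differentiable hf hg k (Nat.lt_succ_iff.1 (Finset.mem_range.1 hk)),
    add_apply, mul_add]

lemma taylorPoly_sum {d : ℕ} (m : ℕ) {ι : Type*} (s : Finset ι) {f : ι → Space d → ℝ}
    (hf : ∀ i ∈ s, ContDiff ℝ (⊤ : ℕ∞) (f i)) (x z : Space d) :
    taylorPoly m (fun x => ∑ i ∈ s, f i x) x z = ∑ i ∈ s, taylorPoly m (f i) x z := by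
  simp only [taylorPoly]
  rw [Finset.sum_comm]
  refine Finset.sum_congr rfl fun k _ => ?_
  have := iteratedFDeriv_sum (𝕜 := ℝ) (f := f) (u := s) (i := k)
    (fun i hi => (hf i hi).of_le (by exact_mod_cast le_top))
  rw [← Finset.mul_sum, this, Finset.sum_apply, sum_apply]

/-- The function `φ`, moved to the point `a`, with bandwidth `h` and amplitude `c`. -/
noncomputable def rescale {d : ℕ} (φ : Space d → ℝ) (c h : ℝ) (a : Space d) : Space d → ℝ :=
  fun y => c * φ (h⁻¹ • (y - a))

lemma contDiff_rescale {d : ℕ} {φ : Space d → ℝ} (hφ : ContDiff ℝ (⊤ : ℕ∞) φ) (c h : ℝ)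
    (a : Space d) :
    ContDiff ℝ (⊤ : ℕ∞) (rescale φ c h a) := by
  unfold rescale
  exact contDiff_const.mul (hφ.comp ((contDiff_id.sub contDiff_const).const_smul _))

lemma iteratedFDeriv_rescale {d : ℕ} {φ : Space d → ℝ} (hφ : ContDiff ℝ (⊤ : ℕ∞) φ) (c h : ℝ)
    (a : Space d) (k : ℕ) (x : Space d) :
    iteratedFDeriv ℝ k (rescale φ c h a) x
      = c • (h⁻¹ ^ k • iteratedFDeriv ℝ k φ (h⁻¹ • (x - a))) := by
  have hk : ContDiff ℝ k φ := hφ.of_le (by exact_mod_cast le_top)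
  have h1 : ContDiff ℝ k (fun y => φ (h⁻¹ • y)) := hk.comp (contDiff_const_smul _)
  have h2 : ContDiff ℝ k (fun y => φ (h⁻¹ • (y - a))) :=
    hk.comp ((contDiff_id.sub contDiff_const).const_smul _)
  have := iteratedFDeriv_const_smul_apply' (a := c) (h2.contDiffAt (x := x))
  simp only [smul_eq_mul] at this
  unfold rescale
  rw [this, iteratedFDeriv_comp_sub (f := fun y => φ (h⁻¹ • y)) k a x,
    iteratedFDeriv_comp_const_smul _ hk]

lemma taylorPoly_rescale {d : ℕ} (m : ℕ) {φ : Space d → ℝ} (hφ : ContDiff ℝ (⊤ : ℕ∞) φ)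
    (c h : ℝ) (a x z : Space d) :
    taylorPoly m (rescale φ c h a) x z = c * taylorPoly m φ (h⁻¹ • (x - a)) (h⁻¹ • z) := by
  simp only [taylorPoly, Finset.mul_sum]
  refine Finset.sum_congr rfl fun k _ => ?_
  rw [iteratedFDeriv_rescale hφ, smul_apply,
    smul_apply,
    show (fun _ : Fin k => h⁻¹ • z) = (fun i => (fun _ : Fin k => h⁻¹) i • (fun _ => z) i) from rfl,
    ContinuousMultilinearMap.map_smul_univ]
  simp only [smul_eq_mul, Finset.prod_const, Finset.card_univ, Fintype.card_fin]
  ring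

lemma taylorPoly_eq_zero_of_notMem_tsupport {d : ℕ} (m : ℕ) {f : Space d → ℝ} {x : Space d}
    (hx : x ∉ tsupport f) (z : Space d) : taylorPoly m f x z = 0 := by
  refine Finset.sum_eq_zero fun k _ => ?_
  have : iteratedFDeriv ℝ k f x = 0 := by
    by_contra h
    exact hx (support_iteratedFDeriv_subset k h)
  simp [this]

lemma tsupport_rescale_subset {d : ℕ} {φ : Space d → ℝ}
    (hs : ∀ x, φ x ≠ 0 → ‖x‖ ≤ 1) (c : ℝ) {h : ℝ} (hh : 0 < h) (a : Space d) :
    tsupport (rescale φ c h a) ⊆ Metric.closedBall a h := by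
  refine closure_minimal (fun y hy => ?_) Metric.isClosed_closedBall
  have h1 : φ (h⁻¹ • (y - a)) ≠ 0 := fun h0 => hy (by simp [rescale, h0])
  have h2 := hs _ h1
  rw [norm_smul, norm_inv, Real.norm_eq_abs, abs_of_pos hh, inv_mul_le_iff₀ hh, mul_one] at h2
  rwa [mem_closedBall_iff_norm]

lemma rescale_eq_zero {d : ℕ} {φ : Space d → ℝ}
    (hs : ∀ x, φ x ≠ 0 → ‖x‖ ≤ 1) (c : ℝ) {h : ℝ} (hh : 0 < h) {a y : Space d}
    (hy : y ∉ Metric.closedBall a h) : rescale φ c h a y = 0 := by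
  by_contra h0
  exact hy (tsupport_rescale_subset hs c hh a (subset_tsupport _ h0))

/-- A sum of bumps of various bandwidths with disjoint supports satisfies the Hölder remainder
bound with twice the constant of one bump, whatever the number of bumps: given `x` and `y`, only
the bump around `x` and the bump around `y` have a nonzero remainder. -/
lemma abs_sum_rescale_sub_taylorPoly_le {d : ℕ} {α K A : ℝ} {m : ℕ} {φ : Space d → ℝ}
    (hφ : ContDiff ℝ (⊤ : ℕ∞) φ) (hs : ∀ x, φ x ≠ 0 → ‖x‖ ≤ 1) (hK0 : 0 ≤ K) (hA0 : 0 ≤ A)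
    (hK : ∀ x y : Space d, |φ y - taylorPoly m φ x (y - x)| ≤ K * ‖x - y‖ ^ α)
    {ι : Type*} (s : Finset ι) (c h : ι → ℝ) (a : ι → Space d) (hh : ∀ i ∈ s, 0 < h i)
    (hdisj : (s : Set ι).PairwiseDisjoint fun i => Metric.closedBall (a i) (h i))
    (hc : ∀ i ∈ s, |c i| ≤ A * h i ^ α) (x y : Space d) :
    |(∑ i ∈ s, rescale φ (c i) (h i) (a i) y)
      - taylorPoly m (fun y => ∑ i ∈ s, rescale φ (c i) (h i) (a i) y) x (y - x)|
      ≤ 2 * (A * K) * ‖x - y‖ ^ α := by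
  classical
  rw [taylorPoly_sum m s (fun i _ => contDiff_rescale hφ _ _ _), ← Finset.sum_sub_distrib]
  set M := A * K * ‖x - y‖ ^ α with hM
  have hM0 : 0 ≤ M := by positivity
  have hone : ∀ i ∈ s, |rescale φ (c i) (h i) (a i) y
      - taylorPoly m (rescale φ (c i) (h i) (a i)) x (y - x)| ≤ M := by
    intro i hi
    have hhi := hh i hi
    rw [taylorPoly_rescale m hφ]
    have e1 : (h i)⁻¹ • (y - x) = (h i)⁻¹ • (y - a i) - (h i)⁻¹ • (x - a i) := by
      rw [← smul_sub]; congr 1; abel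
    have e2 : ‖(h i)⁻¹ • (x - a i) - (h i)⁻¹ • (y - a i)‖ = (h i)⁻¹ * ‖x - y‖ := by
      rw [← smul_sub, norm_smul, norm_inv, Real.norm_eq_abs, abs_of_pos hhi]
      congr 2; abel
    rw [rescale, ← mul_sub, abs_mul, e1]
    calc |c i| * _ ≤ (A * h i ^ α) * (K * ((h i)⁻¹ * ‖x - y‖) ^ α) := by
          have := hK ((h i)⁻¹ • (x - a i)) ((h i)⁻¹ • (y - a i))
          rw [e2] at this
          exact mul_le_mul (hc i hi) this (abs_nonneg _) (by positivity)
      _ = M * (h i ^ α * (h i)⁻¹ ^ α) := by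
          rw [Real.mul_rpow (by positivity) (norm_nonneg _), hM]; ring
      _ = M := by
          rw [← Real.mul_rpow hhi.le (by positivity), mul_inv_cancel₀ hhi.ne', Real.one_rpow,
            mul_one]
  have hcard : ∀ w : Space d,
      ∑ i ∈ s, (if w ∈ Metric.closedBall (a i) (h i) then M else 0) ≤ M := by
    intro w
    by_cases hw : ∃ i ∈ s, w ∈ Metric.closedBall (a i) (h i)
    · obtain ⟨i, hi, hwi⟩ := hw
      rw [Finset.sum_eq_single_of_mem i hi, if_pos hwi]
      intro j hj hji
      rw [if_neg]
      intro hwj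
      exact Set.disjoint_left.1 (hdisj hj hi hji) hwj hwi
    · push Not at hw
      rw [Finset.sum_eq_zero fun i hi => if_neg (hw i hi)]
      exact hM0
  calc |∑ i ∈ s, (rescale φ (c i) (h i) (a i) y
        - taylorPoly m (rescale φ (c i) (h i) (a i)) x (y - x))|
      ≤ ∑ i ∈ s, |rescale φ (c i) (h i) (a i) y
        - taylorPoly m (rescale φ (c i) (h i) (a i)) x (y - x)| := Finset.abs_sum_le_sum_abs _ _
    _ ≤ ∑ i ∈ s, ((if x ∈ Metric.closedBall (a i) (h i) then M else 0)
        + if y ∈ Metric.closedBall (a i) (h i) then M else 0) := by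
        refine Finset.sum_le_sum fun i hi => ?_
        by_cases hx : x ∈ Metric.closedBall (a i) (h i)
        · rw [if_pos hx]
          refine (hone i hi).trans ?_
          split_ifs <;> linarith
        · by_cases hy : y ∈ Metric.closedBall (a i) (h i)
          · rw [if_pos hy, if_neg hx, zero_add]
            exact hone i hi
          · rw [rescale_eq_zero hs _ (hh i hi) hy, taylorPoly_eq_zero_of_notMem_tsupport m
              (fun h' => hx (tsupport_rescale_subset hs _ (hh i hi) _ h')), if_neg hx, if_neg hy]
            simp
    _ ≤ M + M := by
        rw [Finset.sum_add_distrib]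
        exact add_le_add (hcard x) (hcard y)
    _ = _ := by rw [hM]; ring

/-! ### Perturbations inside the class of densities -/

lemma continuous_of_mem_densityClass {d : ℕ} {α L c : ℝ} (hα : 0 < α) {p : Space d → ℝ}
    (hp : p ∈ densityClass d α L c) : Continuous p := by
  obtain ⟨⟨hdiff, hrem⟩, -⟩ := hp
  rcases Nat.eq_zero_or_pos (smoothOrder α) with hm | hm
  · have h1 : ∀ x y : Space d, |p y - p x| ≤ L * ‖x - y‖ ^ α := by
      intro x y
      simpa [hm, taylorPoly] using hrem x y
    refine continuous_iff_continuousAt.2 fun x => ?_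
    rw [ContinuousAt, tendsto_iff_norm_sub_tendsto_zero]
    have h2 : Filter.Tendsto (fun y => L * ‖x - y‖ ^ α) (nhds x) (nhds 0) := by
      have : Continuous fun y : Space d => L * ‖x - y‖ ^ α :=
        continuous_const.mul ((continuous_const.sub continuous_id).norm.rpow_const
          fun _ => Or.inr hα.le)
      have h3 := this.tendsto x
      simpa [Real.zero_rpow hα.ne'] using h3
    exact squeeze_zero (fun _ => norm_nonneg _) (fun y => h1 x y) h2
  · have h0 := (hdiff 0 hm).continuous
    rw [iteratedFDeriv_zero_eq_comp] at h0
    exact (LinearIsometryEquiv.comp_continuous_iff _).1 h0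

lemma integrable_of_mem_densityClass {d : ℕ} {α L c : ℝ} {p : Space d → ℝ}
    (hp : p ∈ densityClass d α L c) : Integrable p :=
  Integrable.of_integral_ne_zero (by rw [hp.2.1]; exact one_ne_zero)

/-- Adding a smooth function of integral zero that is dominated by a small multiple of `p₀` and
has a small Hölder remainder keeps a density in a slightly larger class. The pointwise domination
alone yields the condition on increments, since `p₀ y` is bounded in terms of `p₀ x`. -/
lemma add_mem_densityClass {d : ℕ} {α L c δ ε : ℝ} (hc : 0 < c) (hc' : c < 1 / 2) (hL : 0 < L)
    {p₀ F : Space d → ℝ} (hp : p₀ ∈ densityClass d α L c) (hF : ContDiff ℝ (⊤ : ℕ∞) F)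
    (hFi : Integrable F) (hF0 : ∫ x, F x = 0) (hFp : ∀ x, |F x| ≤ ε * p₀ x)
    (hrem : ∀ x y : Space d,
      |F y - taylorPoly (smoothOrder α) F x (y - x)| ≤ δ * L * ‖x - y‖ ^ α)
    (hε0 : 0 ≤ ε) (hε1 : ε ≤ 1) (hεδ : ε ≤ δ) (hεc : c + 3 * ε ≤ (1 + δ) * c * (1 - ε)) :
    (fun x => p₀ x + F x) ∈ densityClass d α ((1 + δ) * L) ((1 + δ) * c) := by
  have hpi := integrable_of_mem_densityClass hp
  obtain ⟨⟨hdiff, hprem⟩, hint, hnn, hinc⟩ := hp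
  have hFd : ∀ k < smoothOrder α, Differentiable ℝ (iteratedFDeriv ℝ k F) := fun k _ =>
    hF.differentiable_iteratedFDeriv (by exact_mod_cast WithTop.coe_lt_top k)
  refine ⟨⟨fun k hk => ?_, fun x y => ?_⟩, ?_, fun x => ?_, fun x y => ?_⟩
  · rw [iteratedFDeriv_add_of_differentiable hdiff hFd k hk.le]
    exact (hdiff k hk).add (hFd k hk)
  · rw [taylorPoly_add hdiff hFd]
    calc |p₀ y + F y - (taylorPoly (smoothOrder α) p₀ x (y - x)
          + taylorPoly (smoothOrder α) F x (y - x))|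
        = |(p₀ y - taylorPoly (smoothOrder α) p₀ x (y - x))
          + (F y - taylorPoly (smoothOrder α) F x (y - x))| := by ring_nf
      _ ≤ L * ‖x - y‖ ^ α + δ * L * ‖x - y‖ ^ α :=
          (abs_add_le _ _).trans (add_le_add (hprem x y) (hrem x y))
      _ = _ := by ring
  · rw [integral_add hpi hFi, hint, hF0, add_zero]
  · have := (abs_le.1 (hFp x)).1
    have h2 := hnn x
    nlinarith
  · set D := ‖x - y‖ ^ α with hD
    have hD0 : 0 ≤ L * D := mul_nonneg hL.le (Real.rpow_nonneg (norm_nonneg _) _)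
    have hx := hFp x
    have hy := hFp y
    have hxy := hinc x y
    have hpx := hnn x
    have hy' : p₀ y ≤ (1 + c) * p₀ x + L * D := by linarith [(abs_le.1 hxy).1]
    have h1 : |p₀ x + F x - (p₀ y + F y)| ≤ |p₀ x - p₀ y| + |F x| + |F y| := by
      calc |p₀ x + F x - (p₀ y + F y)| = |(p₀ x - p₀ y) + (F x - F y)| := by ring_nf
        _ ≤ |p₀ x - p₀ y| + |F x - F y| := abs_add_le _ _
        _ ≤ _ := by linarith [abs_sub (F x) (F y)]
    have h2 : ε * p₀ y ≤ ε * ((1 + c) * p₀ x + L * D) := by gcongr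
    have h3 : (1 - ε) * p₀ x ≤ p₀ x + F x := by linarith [(abs_le.1 hx).1]
    have h4 : (1 + δ) * c * ((1 - ε) * p₀ x) ≤ (1 + δ) * c * (p₀ x + F x) := by
      have : 0 ≤ (1 + δ) * c := by nlinarith
      gcongr
    have h5 : (c + 3 * ε) * p₀ x ≤ (1 + δ) * c * (1 - ε) * p₀ x := by gcongr
    have h6 : ε * (L * D) ≤ δ * (L * D) := by gcongr
    have h7 : ε * (c * p₀ x) ≤ ε * (1 / 2 * p₀ x) := by gcongr
    have h8 : 0 ≤ ε * p₀ x := mul_nonneg hε0 hpx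
    calc |p₀ x + F x - (p₀ y + F y)| ≤ (c * p₀ x + L * D) + ε * p₀ x
          + ε * ((1 + c) * p₀ x + L * D) := by linarith
      _ = (c + 2 * ε) * p₀ x + ε * (c * p₀ x) + L * D + ε * (L * D) := by ring
      _ ≤ (c + 3 * ε) * p₀ x + L * D + δ * (L * D) := by linarith
      _ ≤ (1 + δ) * c * (1 - ε) * p₀ x + L * D + δ * (L * D) := by linarith
      _ ≤ (1 + δ) * c * (p₀ x + F x) + (1 + δ) * L * D := by linarith

/-- A smooth bump of integral zero, supported in the unit ball and bounded below in absolute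
value on some ball: a coordinate function times an even cut-off. -/
lemma exists_bump {d : ℕ} (hd : 1 ≤ d) :
    ∃ φ : Space d → ℝ, ContDiff ℝ (⊤ : ℕ∞) φ ∧ HasCompactSupport φ ∧
      (∀ x, φ x ≠ 0 → ‖x‖ ≤ 1) ∧ (∀ x, |φ x| ≤ 1) ∧ (∫ x, φ x = 0) ∧
      ∃ (v : Space d) (q ρ : ℝ), 0 < q ∧ 0 < ρ ∧ ∀ x ∈ Metric.ball v ρ, q ≤ |φ x| := by
  let i₀ : Fin d := ⟨0, hd⟩
  let f : ContDiffBump (0 : Space d) := ⟨1 / 2, 1, by norm_num, by norm_num⟩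
  have hcoord : ContDiff ℝ (⊤ : ℕ∞) fun x : Space d => x i₀ := by fun_prop
  have hsm : ContDiff ℝ (⊤ : ℕ∞) fun x : Space d => x i₀ * f x := hcoord.mul f.contDiff
  have hsupp : ∀ x : Space d, x i₀ * f x ≠ 0 → ‖x‖ ≤ 1 := by
    intro x hx
    have : x ∈ Function.support f := right_ne_zero_of_mul hx
    rw [f.support_eq, mem_ball_zero_iff] at this
    exact this.le
  refine ⟨fun x => x i₀ * f x, hsm, f.hasCompactSupport.mul_left, hsupp, fun x => ?_, ?_, ?_⟩
  · by_cases hx : x i₀ * f x = 0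
    · simp [hx]
    · have h1 : |x i₀| ≤ 1 := (PiLp.norm_apply_le x i₀).trans (hsupp x hx)
      rw [abs_mul, abs_of_nonneg (f.nonneg' x)]
      exact mul_le_one₀ h1 (f.nonneg' x) f.le_one
  · have h := integral_neg_eq_self (fun x : Space d => x i₀ * f x) volume
    have h2 : (fun x : Space d => (-x) i₀ * f (-x)) = fun x => -(x i₀ * f x) := by
      ext x
      rw [f.neg]
      simp
    rw [h2, integral_neg] at h
    linarith
  · let v : Space d := EuclideanSpace.single i₀ (1 / 4 : ℝ)
    have hv : v i₀ * f v = 1 / 4 := by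
      have h1 : f v = 1 := by
        refine f.one_of_mem_closedBall ?_
        rw [mem_closedBall_zero_iff, PiLp.norm_single]
        norm_num [f]
      rw [h1]
      simp [v]
    have hopen : IsOpen {x : Space d | 1 / 8 < x i₀ * f x} :=
      isOpen_lt continuous_const hsm.continuous
    obtain ⟨ρ, hρ, hb⟩ := Metric.isOpen_iff.1 hopen v (by rw [mem_ofPred_eq, hv]; norm_num)
    exact ⟨v, 1 / 8, ρ, by norm_num, hρ, fun x hx => (hb hx).le.trans (le_abs_self _)⟩

lemma abs_rescale_le {d : ℕ} {φ : Space d → ℝ} (hφ : ∀ x, |φ x| ≤ 1) (c h : ℝ) (a y : Space d) :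
    |rescale φ c h a y| ≤ |c| := by
  rw [rescale, abs_mul]
  exact mul_le_of_le_one_right (abs_nonneg c) (hφ _)

lemma integral_rescale {d : ℕ} {φ : Space d → ℝ} (hφ : ∫ x, φ x = 0) (c h : ℝ) (a : Space d) :
    ∫ y, rescale φ c h a y = 0 := by
  unfold rescale
  rw [integral_const_mul, integral_sub_right_eq_self (fun y => φ (h⁻¹ • y)) a,
    Measure.integral_comp_smul, hφ]
  simp

lemma integrable_rescale {d : ℕ} {φ : Space d → ℝ} (hφ : ContDiff ℝ (⊤ : ℕ∞) φ)
    (hs : ∀ x, φ x ≠ 0 → ‖x‖ ≤ 1) (c : ℝ) {h : ℝ} (hh : 0 < h) (a : Space d) :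
    Integrable (rescale φ c h a) :=
  (contDiff_rescale hφ c h a).continuous.integrable_of_hasCompactSupport
    (HasCompactSupport.intro (isCompact_closedBall a h) fun _ hx => rescale_eq_zero hs c hh hx)

/-! ### Testing against a mixture over random signs -/

lemma pi_withDensity_ofReal {E : Type*} [MeasurableSpace E] {μ : Measure E} [SigmaFinite μ]
    {f : E → ℝ} (hf : Integrable f μ) (h0 : ∀ x, 0 ≤ f x) (n : ℕ) :
    Measure.pi (fun _ : Fin n => μ.withDensity fun x => ENNReal.ofReal (f x))
      = (Measure.pi fun _ : Fin n => μ).withDensity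
          fun X => ENNReal.ofReal (∏ k, f (X k)) := by
  have : IsFiniteMeasure (μ.withDensity fun x => ENNReal.ofReal (f x)) :=
    isFiniteMeasure_withDensity_ofReal hf.2
  refine Measure.pi_eq fun s hs => ?_
  have hms : MeasurableSet (Set.univ.pi s) := MeasurableSet.univ_pi hs
  have hind : ∀ k, Integrable ((s k).indicator f) μ := fun k => hf.indicator (hs k)
  have hprod : ∀ X : Fin n → E, (Set.univ.pi s).indicator (fun X => ∏ k, f (X k)) X
      = ∏ k, (s k).indicator f (X k) := by
    intro X
    by_cases hX : X ∈ Set.univ.pi s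
    · rw [indicator_of_mem hX]
      exact Finset.prod_congr rfl fun k _ => (indicator_of_mem (hX k (mem_univ k)) f).symm
    · rw [indicator_of_notMem hX]
      simp only [mem_pi, mem_univ, true_implies, not_forall] at hX
      obtain ⟨k, hk⟩ := hX
      exact (Finset.prod_eq_zero (Finset.mem_univ k) (indicator_of_notMem hk f)).symm
  have hone : ∀ k, μ.withDensity (fun x => ENNReal.ofReal (f x)) (s k)
      = ENNReal.ofReal (∫ x, (s k).indicator f x ∂μ) := by
    intro k
    rw [withDensity_apply _ (hs k), integral_indicator (hs k),
      ofReal_integral_eq_lintegral_ofReal hf.integrableOn (Filter.Eventually.of_forall h0)]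
  rw [withDensity_apply _ hms, Finset.prod_congr rfl fun k _ => hone k,
    ← ENNReal.ofReal_prod_of_nonneg
      (fun k _ => integral_nonneg fun x => indicator_nonneg (fun x _ => h0 x) x),
    ← integral_fintype_prod_eq_prod (fun k => (s k).indicator f),
    ← ofReal_integral_eq_lintegral_ofReal
      (Integrable.fintype_prod (f := fun _ => f) (fun _ => hf)).integrableOn
      (Filter.Eventually.of_forall fun X => Finset.prod_nonneg fun k _ => h0 _),
    ← integral_indicator hms]
  simp_rw [hprod]

/-- The sign encoded by a Boolean. -/
def sgn (b : Bool) : ℝ := if b then 1 else -1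

lemma abs_sgn (b : Bool) : |sgn b| = 1 := by cases b <;> simp [sgn]

/-- The exponential moment of a Rademacher sum, as a sum over all sign patterns. -/
lemma sum_exp_sgn_le {ι : Type*} [Fintype ι] [DecidableEq ι] (e : ι → Bool) (a : ι → ℝ) :
    ∑ e' : ι → Bool, Real.exp (∑ i, sgn (e i) * sgn (e' i) * a i)
      ≤ Fintype.card (ι → Bool) * Real.exp ((∑ i, a i ^ 2) / 2) := by
  have h1 : ∀ i, ∑ b : Bool, Real.exp (sgn (e i) * sgn b * a i) = 2 * Real.cosh (a i) := by
    intro i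
    rw [Fintype.sum_bool, Real.cosh_eq]
    cases e i <;> simp [sgn] <;> ring
  have h2 : ∑ e' : ι → Bool, Real.exp (∑ i, sgn (e i) * sgn (e' i) * a i)
      = ∏ i, (2 * Real.cosh (a i)) := by
    simp_rw [Real.exp_sum]
    rw [← Fintype.piFinset_univ, ← Finset.prod_congr rfl fun i _ => h1 i]
    exact (Finset.prod_univ_sum (fun _ => Finset.univ)
      fun i b => Real.exp (sgn (e i) * sgn b * a i)).symm
  rw [h2, Finset.prod_mul_distrib, Finset.prod_const, Finset.card_univ, Fintype.card_fun,
    Fintype.card_bool, Finset.sum_div, Real.exp_sum]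
  push_cast
  gcongr with i
  exact Real.cosh_le_exp_half_sq _

/-- **Second-moment bound for a mixture over random signs.** Let `g i` be centred and orthogonal
in `L²(μ)`. The likelihood ratio of the uniform mixture of the product measures with
densities `∏ (1 + ∑ i, ± g i)` has chi-square divergence at most
`exp (n² ∑ (∫ g i ²)² / 2) - 1`, so no set separates this mixture from `μⁿ`. -/
lemma exists_sgn_le_measureReal {E : Type*} [MeasurableSpace E] {μ : Measure E}
    [IsProbabilityMeasure μ] {ι : Type*} [Fintype ι] {g : ι → E → ℝ}
    (hgm : ∀ i, Measurable (g i)) (hgb : ∀ i x, |g i x| ≤ 1) (hg0 : ∀ i, ∫ x, g i x ∂μ = 0)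
    (horth : ∀ i j, i ≠ j → ∀ x, g i x * g j x = 0)
    (hpos : ∀ (e : ι → Bool) (x : E), 0 ≤ 1 + ∑ i, sgn (e i) * g i x)
    (n : ℕ) {τ : ℝ} (hτ : 0 < τ)
    (hchi : Real.exp ((∑ i, (n * ∫ x, g i x ^ 2 ∂μ) ^ 2) / 2) - 1 ≤ τ ^ 2)
    {A : Set (Fin n → E)} (hA : MeasurableSet A) :
    ∃ e : ι → Bool, 1 - τ ≤ (Measure.pi fun _ : Fin n => μ).real Aᶜ
      + (Measure.pi fun _ : Fin n => μ.withDensity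
          fun x => ENNReal.ofReal (1 + ∑ i, sgn (e i) * g i x)).real A := by
  classical
  set P : Measure (Fin n → E) := Measure.pi fun _ : Fin n => μ with hP
  set G : (ι → Bool) → E → ℝ := fun e x => 1 + ∑ i, sgn (e i) * g i x with hG
  have hgi : ∀ i, Integrable (g i) μ := fun i =>
    Integrable.of_bound (hgm i).aestronglyMeasurable 1
      (Filter.Eventually.of_forall fun x => hgb i x)
  have hGi : ∀ e, Integrable (G e) μ := fun e =>
    (integrable_const _).add (integrable_finsetSum _ fun i _ => (hgi i).const_mul _)
  have hGint : ∀ e, ∫ x, G e x ∂μ = 1 := by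
    intro e
    rw [hG, integral_add (integrable_const _)
      (integrable_finsetSum _ fun i _ => (hgi i).const_mul _),
      integral_finsetSum _ fun i _ => (hgi i).const_mul _]
    simp [integral_const_mul, hg0]
  have hg2i : ∀ i, Integrable (fun x => g i x ^ 2) μ := fun i =>
    Integrable.of_bound ((hgm i).pow_const 2).aestronglyMeasurable 1
      (Filter.Eventually.of_forall fun x => by
        rw [norm_pow]; exact pow_le_one₀ (norm_nonneg _) (hgb i x))
  -- disjointness of the supports makes the product of two perturbations diagonal
  have hGG : ∀ e e' x, G e x * G e' x = G e x + (∑ i, sgn (e' i) * g i x)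
      + ∑ i, sgn (e i) * sgn (e' i) * g i x ^ 2 := by
    intro e e' x
    have : (∑ i, sgn (e i) * g i x) * (∑ i, sgn (e' i) * g i x)
        = ∑ i, sgn (e i) * sgn (e' i) * g i x ^ 2 := by
      rw [Finset.sum_mul_sum]
      refine Finset.sum_congr rfl fun i _ => ?_
      rw [Finset.sum_eq_single_of_mem i (Finset.mem_univ i)]
      · ring
      · intro j _ hji
        calc sgn (e i) * g i x * (sgn (e' j) * g j x)
            = sgn (e i) * sgn (e' j) * (g i x * g j x) := by ring
          _ = 0 := by rw [horth i j hji.symm, mul_zero]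
    rw [← this, hG]
    ring
  have hGGi1 : ∀ e e' : ι → Bool, Integrable (fun x => G e x + ∑ i, sgn (e' i) * g i x) μ :=
    fun e e' => (hGi e).add (integrable_finsetSum _ fun i _ => (hgi i).const_mul _)
  have hGGi2 : ∀ e e' : ι → Bool,
      Integrable (fun x => ∑ i, sgn (e i) * sgn (e' i) * g i x ^ 2) μ :=
    fun e e' => integrable_finsetSum _ fun i _ => (hg2i i).const_mul _
  have hGGi : ∀ e e', Integrable (fun x => G e x * G e' x) μ := by
    intro e e'
    simp_rw [hGG]
    exact (hGGi1 e e').add (hGGi2 e e')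
  set a : ι → ℝ := fun i => ∫ x, g i x ^ 2 ∂μ with ha
  have hGGint : ∀ e e', ∫ x, G e x * G e' x ∂μ = 1 + ∑ i, sgn (e i) * sgn (e' i) * a i := by
    intro e e'
    simp_rw [hGG]
    rw [integral_add (hGGi1 e e') (hGGi2 e e'),
      integral_add (hGi e) (integrable_finsetSum _ fun i _ => (hgi i).const_mul _),
      hGint, integral_finsetSum _ fun i _ => (hgi i).const_mul _,
      integral_finsetSum _ fun i _ => (hg2i i).const_mul _]
    simp [integral_const_mul, hg0, ha]
  -- the likelihood ratios and their average
  set R : (ι → Bool) → (Fin n → E) → ℝ := fun e X => ∏ k, G e (X k) with hR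
  have hRi : ∀ e, Integrable (R e) P := fun e =>
    Integrable.fintype_prod (f := fun _ => G e) fun _ => hGi e
  have hRint : ∀ e, ∫ X, R e X ∂P = 1 := by
    intro e
    rw [hR, hP, integral_fintype_prod_eq_prod (fun _ => G e)]
    simp [hGint]
  have hRR : ∀ e e', (fun X => R e X * R e' X) = fun X => ∏ k, (G e (X k) * G e' (X k)) := by
    intro e e'
    ext X
    rw [hR, Finset.prod_mul_distrib]
  have hRRi : ∀ e e', Integrable (fun X => R e X * R e' X) P := by
    intro e e'
    rw [hRR]
    exact Integrable.fintype_prod (f := fun _ x => G e x * G e' x) fun _ => hGGi e e'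
  have hRRint : ∀ e e', ∫ X, R e X * R e' X ∂P
      ≤ Real.exp (∑ i, sgn (e i) * sgn (e' i) * (n * a i)) := by
    intro e e'
    rw [hRR, hP, integral_fintype_prod_eq_prod (fun _ x => G e x * G e' x), Finset.prod_const,
      Finset.card_univ, Fintype.card_fin]
    have h0 : 0 ≤ ∫ x, G e x * G e' x ∂μ :=
      integral_nonneg fun x => mul_nonneg (hpos e x) (hpos e' x)
    have h1 : ∫ x, G e x * G e' x ∂μ ≤ Real.exp (∑ i, sgn (e i) * sgn (e' i) * a i) := by
      rw [hGGint]
      linarith [Real.add_one_le_exp (∑ i, sgn (e i) * sgn (e' i) * a i)]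
    refine (pow_le_pow_left₀ h0 h1 n).trans (le_of_eq ?_)
    rw [← Real.exp_nat_mul, Finset.mul_sum]
    congr 1
    exact Finset.sum_congr rfl fun i _ => by ring
  set N : ℝ := (Fintype.card (ι → Bool) : ℝ) with hN
  have hN0 : 0 < N := by
    rw [hN]
    exact_mod_cast Fintype.card_pos
  set Λ : (Fin n → E) → ℝ := fun X => N⁻¹ * ∑ e, R e X with hΛ
  have hΛi : Integrable Λ P := (integrable_finsetSum _ fun e _ => hRi e).const_mul _
  have hΛint : ∫ X, Λ X ∂P = 1 := by
    rw [hΛ, integral_const_mul, integral_finsetSum _ fun e _ => hRi e]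
    simp_rw [hRint]
    rw [Finset.sum_const, Finset.card_univ, nsmul_eq_mul, mul_one]
    exact inv_mul_cancel₀ hN0.ne'
  have hΛ2 : ∀ X, Λ X ^ 2 = N⁻¹ ^ 2 * ∑ e, ∑ e', R e X * R e' X := by
    intro X
    rw [hΛ, mul_pow, sq (∑ e, R e X), Finset.sum_mul_sum]
  have hΛ2i : Integrable (fun X => Λ X ^ 2) P := by
    simp_rw [hΛ2]
    exact (integrable_finsetSum _ fun e _ =>
      integrable_finsetSum _ fun e' _ => hRRi e e').const_mul _
  have hΛ2int : ∫ X, Λ X ^ 2 ∂P ≤ 1 + τ ^ 2 := by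
    simp_rw [hΛ2]
    rw [integral_const_mul, integral_finsetSum _
      fun e _ => integrable_finsetSum _ fun e' _ => hRRi e e']
    have h1 : ∀ e : ι → Bool, ∫ X, ∑ e', R e X * R e' X ∂P
        ≤ N * Real.exp ((∑ i, (n * a i) ^ 2) / 2) := by
      intro e
      rw [integral_finsetSum _ fun e' _ => hRRi e e']
      exact (Finset.sum_le_sum fun e' _ => hRRint e e').trans
        (sum_exp_sgn_le e fun i => n * a i)
    calc N⁻¹ ^ 2 * ∑ e, ∫ X, ∑ e', R e X * R e' X ∂P
        ≤ N⁻¹ ^ 2 * (N * (N * Real.exp ((∑ i, (n * a i) ^ 2) / 2))) := by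
          gcongr
          refine (Finset.sum_le_sum fun e _ => h1 e).trans (le_of_eq ?_)
          rw [Finset.sum_const, Finset.card_univ, nsmul_eq_mul]
      _ = Real.exp ((∑ i, (n * a i) ^ 2) / 2) := by field_simp
      _ ≤ 1 + τ ^ 2 := by linarith
  -- `|1 - Λ| ≤ τ / 2 + (1 - Λ)² / (2 τ)` replaces the Cauchy–Schwarz inequality
  have hAL : ∫ X in A, (1 - Λ X) ∂P ≤ τ := by
    have hi0 : Integrable (fun X => 1 - 2 * Λ X) P := (integrable_const _).sub (hΛi.const_mul 2)
    have hi1 : Integrable (fun X => (1 - 2 * Λ X + Λ X ^ 2) / (2 * τ)) P :=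
      (hi0.add hΛ2i).div_const _
    have hi2 : Integrable (fun X => τ / 2 + (1 - 2 * Λ X + Λ X ^ 2) / (2 * τ)) P :=
      (integrable_const _).add hi1
    calc ∫ X in A, (1 - Λ X) ∂P
        ≤ ∫ X in A, (τ / 2 + (1 - 2 * Λ X + Λ X ^ 2) / (2 * τ)) ∂P := by
          refine integral_mono ((integrable_const _).sub hΛi).integrableOn hi2.integrableOn
            fun X => ?_
          change 1 - Λ X ≤ τ / 2 + (1 - 2 * Λ X + Λ X ^ 2) / (2 * τ)
          rw [div_add_div _ _ two_ne_zero (by positivity), le_div_iff₀ (by positivity)]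
          nlinarith [sq_nonneg (1 - Λ X - τ)]
      _ ≤ ∫ X, (τ / 2 + (1 - 2 * Λ X + Λ X ^ 2) / (2 * τ)) ∂P := by
          refine setIntegral_le_integral hi2 (Filter.Eventually.of_forall fun X => ?_)
          change 0 ≤ τ / 2 + (1 - 2 * Λ X + Λ X ^ 2) / (2 * τ)
          have : 0 ≤ 1 - 2 * Λ X + Λ X ^ 2 := by nlinarith [sq_nonneg (1 - Λ X)]
          positivity
      _ = τ / 2 + (1 - 2 * 1 + ∫ X, Λ X ^ 2 ∂P) / (2 * τ) := by
          rw [integral_add (integrable_const _) hi1,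
            integral_div (2 * τ), integral_add hi0 hΛ2i,
            integral_sub (integrable_const _) (hΛi.const_mul 2), integral_const_mul, hΛint]
          simp
      _ ≤ τ / 2 + τ ^ 2 / (2 * τ) := by gcongr; linarith
      _ = τ := by field_simp; ring
  have hmass : ∀ e : ι → Bool, (Measure.pi fun _ : Fin n => μ.withDensity
      fun x => ENNReal.ofReal (1 + ∑ i, sgn (e i) * g i x)).real A = ∫ X in A, R e X ∂P := by
    intro e
    rw [pi_withDensity_ofReal (hGi e) (hpos e), measureReal_def, withDensity_apply _ hA,
      ← ofReal_integral_eq_lintegral_ofReal (hRi e).integrableOn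
        (Filter.Eventually.of_forall fun X => Finset.prod_nonneg fun k _ => hpos e _),
      ENNReal.toReal_ofReal (integral_nonneg fun X => Finset.prod_nonneg fun k _ => hpos e _)]
  have havg : ∑ _e : ι → Bool, (1 - τ)
      ≤ ∑ e : ι → Bool, (P.real Aᶜ + ∫ X in A, R e X ∂P) := by
    have h1 : ∫ X in A, (1 - Λ X) ∂P = P.real A - N⁻¹ * ∑ e, ∫ X in A, R e X ∂P := by
      rw [integral_sub (integrable_const _).integrableOn hΛi.integrableOn, hΛ,
        integral_const_mul, integral_finsetSum _ fun e _ => (hRi e).integrableOn]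
      simp
    have h2 : P.real A + P.real Aᶜ = 1 := by
      rw [measureReal_add_measureReal_compl hA]
      simp
    have h3 : 1 - τ ≤ P.real Aᶜ + N⁻¹ * ∑ e, ∫ X in A, R e X ∂P := by linarith
    rw [Finset.sum_add_distrib, Finset.sum_const, Finset.sum_const, Finset.card_univ,
      nsmul_eq_mul, nsmul_eq_mul, ← hN]
    calc N * (1 - τ) ≤ N * (P.real Aᶜ + N⁻¹ * ∑ e, ∫ X in A, R e X ∂P) := by gcongr
      _ = _ := by field_simp
  obtain ⟨e, -, he⟩ := Finset.exists_le_of_sum_le Finset.univ_nonempty havg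
  exact ⟨e, by rw [hmass]; exact he⟩

/-- If all sign combinations of the perturbations `f i` of `p₀` lie in the alternative and the
chi-square divergence of their mixture is at most `τ²`, then every test has risk at
least `1 - τ`. -/
lemma le_minimaxRisk {d : ℕ} {α L cstar δ t ρ τ : ℝ} {n : ℕ} {p₀ : Space d → ℝ}
    (hpm : Measurable p₀) (hp0 : ∀ x, 0 ≤ p₀ x) (hp1 : ∫ x, p₀ x = 1)
    {ι : Type*} [Fintype ι] {f : ι → Space d → ℝ} {a : ι → ℝ}
    (hfm : ∀ i, Measurable (f i)) (hfp : ∀ i x, |f i x| ≤ p₀ x) (hf0 : ∀ i, ∫ x, f i x = 0)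
    (horth : ∀ i j, i ≠ j → ∀ x, f i x * f j x = 0)
    (hpos : ∀ (e : ι → Bool) (x : Space d), |∑ i, sgn (e i) * f i x| ≤ p₀ x)
    (ha : ∀ i, ∫ x, p₀ x * (f i x / p₀ x) ^ 2 ≤ a i)
    (hτ : 0 < τ) (hchi : Real.exp ((∑ i, (n * a i) ^ 2) / 2) - 1 ≤ τ ^ 2)
    (halt : ∀ e : ι → Bool,
      (fun x => p₀ x + ∑ i, sgn (e i) * f i x) ∈ alternative α L cstar δ t p₀ ρ) :
    ENNReal.ofReal (1 - τ) ≤ minimaxRisk α L cstar δ t n p₀ ρ := by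
  have hpi : Integrable p₀ := Integrable.of_integral_ne_zero (by rw [hp1]; exact one_ne_zero)
  set μ : Measure (Space d) := volume.withDensity fun x => ENNReal.ofReal (p₀ x) with hμ
  have hμp : IsProbabilityMeasure μ := by
    refine ⟨?_⟩
    rw [hμ, withDensity_apply _ MeasurableSet.univ, Measure.restrict_univ,
      ← ofReal_integral_eq_lintegral_ofReal hpi (Filter.Eventually.of_forall hp0), hp1,
      ENNReal.ofReal_one]
  have hpE : Measurable fun x => ENNReal.ofReal (p₀ x) := hpm.ennreal_ofReal
  have hint : ∀ u : Space d → ℝ, ∫ x, u x ∂μ = ∫ x, p₀ x * u x := by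
    intro u
    rw [hμ, integral_withDensity_eq_integral_toReal_smul hpE
      (Filter.Eventually.of_forall fun x => ENNReal.ofReal_lt_top)]
    simp only [ENNReal.toReal_ofReal (hp0 _), smul_eq_mul]
  -- where `p₀` vanishes, so do the perturbations, hence the junk value of the quotient is harmless
  have hzero : ∀ i x, p₀ x = 0 → f i x = 0 := fun i x hx =>
    abs_nonpos_iff.1 ((hfp i x).trans hx.le)
  have hcancel : ∀ i x, p₀ x * (f i x / p₀ x) = f i x := by
    intro i x
    rcases eq_or_ne (p₀ x) 0 with hx | hx
    · rw [hx, zero_mul, hzero i x hx]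
    · exact mul_div_cancel₀ _ hx
  have hsum : ∀ (e : ι → Bool) x, p₀ x * ∑ i, sgn (e i) * (f i x / p₀ x)
      = ∑ i, sgn (e i) * f i x := by
    intro e x
    rw [Finset.mul_sum]
    refine Finset.sum_congr rfl fun i _ => ?_
    rw [mul_left_comm, hcancel]
  have hpos' : ∀ (e : ι → Bool) x, 0 ≤ 1 + ∑ i, sgn (e i) * (f i x / p₀ x) := by
    intro e x
    rcases (hp0 x).eq_or_lt with hx | hx
    · simp [← hx]
    · have h1 := (abs_le.1 (hpos e x)).1
      rw [← hsum] at h1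
      nlinarith
  have hdens : ∀ e : ι → Bool, (volume : Measure (Space d)).withDensity
      (fun x => ENNReal.ofReal (p₀ x + ∑ i, sgn (e i) * f i x))
      = μ.withDensity fun x => ENNReal.ofReal (1 + ∑ i, sgn (e i) * (f i x / p₀ x)) := by
    intro e
    have hm : Measurable fun x => ENNReal.ofReal (1 + ∑ i, sgn (e i) * (f i x / p₀ x)) :=
      (measurable_const.add (Finset.measurable_fun_sum _ fun i _ =>
        ((hfm i).div hpm).const_mul _)).ennreal_ofReal
    rw [hμ, ← withDensity_mul _ hpE hm]
    congr 1
    ext x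
    rw [Pi.mul_apply, ← ENNReal.ofReal_mul (hp0 x), mul_add, mul_one, hsum]
  refine le_iInf₂ fun ψ hψ => ?_
  have hA : MeasurableSet {X : Fin n → Space d | ψ X = 0} := hψ (measurableSet_singleton 0)
  have hAc : {X : Fin n → Space d | ψ X = 1} = {X : Fin n → Space d | ψ X = 0}ᶜ := by
    ext X
    simp only [mem_ofPred_eq, mem_compl_iff]
    omega
  have hchi' : Real.exp ((∑ i, (n * ∫ x, (f i x / p₀ x) ^ 2 ∂μ) ^ 2) / 2) - 1 ≤ τ ^ 2 := by
    refine le_trans ?_ hchi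
    gcongr with i
    rw [hint]
    exact ha i
  obtain ⟨e, he⟩ := exists_sgn_le_measureReal (μ := μ) (g := fun i x => f i x / p₀ x)
    (fun i => (hfm i).div hpm)
    (fun i x => by
      rw [abs_div, abs_of_nonneg (hp0 x)]
      exact div_le_one_of_le₀ (hfp i x) (hp0 x))
    (fun i => by rw [hint]; simp_rw [hcancel]; exact hf0 i)
    (fun i j hij x => by rw [div_mul_div_comm, horth i j hij x, zero_div])
    hpos' n hτ hchi' hA
  have hfin : ∀ e : ι → Bool, IsFiniteMeasure (μ.withDensity
      fun x => ENNReal.ofReal (1 + ∑ i, sgn (e i) * (f i x / p₀ x))) := by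
    intro e
    rw [← hdens]
    exact isFiniteMeasure_withDensity_ofReal
      (integrable_of_mem_densityClass (halt e).1).2
  rw [risk, hAc]
  have hrisk : ENNReal.ofReal (1 - τ) ≤ sampleLaw n p₀ {X | ψ X = 0}ᶜ
      + sampleLaw n (fun x => p₀ x + ∑ i, sgn (e i) * f i x) {X | ψ X = 0} := by
    rw [sampleLaw, sampleLaw, hdens]
    have := hfin e
    refine (ENNReal.ofReal_le_ofReal he).trans ?_
    rw [ENNReal.ofReal_add measureReal_nonneg measureReal_nonneg, ofReal_measureReal,
      ofReal_measureReal]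
  refine hrisk.trans (add_le_add_right ?_ _)
  exact le_iSup₂ (f := fun p (_ : p ∈ alternative α L cstar δ t p₀ ρ) =>
    sampleLaw n p {X | ψ X = 0}) _ (halt e)

/-! ### The risk against a family of bumps -/

/-- Around a point where the Hölder increment is at most a quarter of the density, the density
is comparable to its value at that point. -/
lemma comparable_of_mem_densityClass {d : ℕ} {α L c : ℝ} (hc' : c < 1 / 2) {p : Space d → ℝ}
    (hp : p ∈ densityClass d α L c) {x y : Space d} (hxy : L * ‖x - y‖ ^ α ≤ p x / 4) :
    p x ≤ 4 * p y ∧ p y ≤ 2 * p x := by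
  have h := abs_le.1 (hp.2.2.2 x y)
  have h0 := hp.2.2.1 x
  constructor <;> nlinarith [h.1, h.2]

/-- Random signs on disjointly supported bumps of amplitudes `β * L * h i ^ α`: if the bumps are
small compared with `p₀`, have small chi-square cost and are large enough in `L_t`, then no test
at distance `ρ` has risk below `1 - τ`. -/
lemma le_minimaxRisk_of_bumps {d : ℕ} {α L cstar δ t ρ τ ε K β q w : ℝ} {n : ℕ}
    {p₀ φ : Space d → ℝ} {v : Space d} (hα : 0 < α) (hL : 0 < L) (ht : 1 ≤ t)
    (hc : 0 < cstar) (hc' : cstar < 1 / 2) (hp : p₀ ∈ densityClass d α L cstar)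
    (hφ : ContDiff ℝ (⊤ : ℕ∞) φ) (hs : ∀ x, φ x ≠ 0 → ‖x‖ ≤ 1) (hφ1 : ∀ x, |φ x| ≤ 1)
    (hφ0 : ∫ x, φ x = 0) (hq : 0 < q) (hw : 0 < w) (hv : ∀ x ∈ Metric.ball v w, q ≤ |φ x|)
    (hK0 : 0 ≤ K)
    (hK : ∀ x y : Space d, |φ y - taylorPoly (smoothOrder α) φ x (y - x)| ≤ K * ‖x - y‖ ^ α)
    (hε0 : 0 ≤ ε) (hε1 : ε ≤ 1) (hεδ : ε ≤ δ)
    (hεc : cstar + 3 * ε ≤ (1 + δ) * cstar * (1 - ε)) (hβ : 0 < β) (hβK : 2 * β * K ≤ δ)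
    {ι : Type*} [Fintype ι] {a : ι → Space d} {h : ι → ℝ} (hh : ∀ i, 0 < h i)
    (hdisj : Pairwise fun i j =>
      Disjoint (Metric.closedBall (a i) (h i)) (Metric.closedBall (a j) (h j)))
    (hpa : ∀ i, 0 < p₀ (a i))
    (hcmp : ∀ i, ∀ y ∈ Metric.closedBall (a i) (h i), p₀ (a i) ≤ 4 * p₀ y)
    (hamp : ∀ i, β * L * h i ^ α ≤ ε / 4 * p₀ (a i)) (hτ : 0 < τ)
    (hchi : Real.exp ((∑ i, (n * (4 * (β * L * h i ^ α) ^ 2 / p₀ (a i)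
      * (h i ^ d * (volume : Measure (Space d)).real (Metric.ball 0 1)))) ^ 2) / 2) - 1 ≤ τ ^ 2)
    (hρ0 : 0 ≤ ρ)
    (hρ : ρ ^ t ≤ ∑ i, (β * L * h i ^ α * q) ^ t
      * ((h i * w) ^ d * (volume : Measure (Space d)).real (Metric.ball 0 1))) :
    ENNReal.ofReal (1 - τ) ≤ minimaxRisk α L cstar δ t n p₀ ρ := by
  classical
  have hcont := continuous_of_mem_densityClass hα hp
  have hnn : ∀ x, 0 ≤ p₀ x := hp.2.2.1
  set V := (volume : Measure (Space d)).real (Metric.ball 0 1) with hV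
  have hvol : ∀ (x : Space d) (s : ℝ), 0 ≤ s →
      (volume : Measure (Space d)).real (Metric.closedBall x s) = s ^ d * V := by
    intro x s hs0
    rw [measureReal_def, Measure.addHaar_closedBall _ _ hs0, ENNReal.toReal_mul,
      ENNReal.toReal_ofReal (by positivity), finrank_euclideanSpace_fin, hV, measureReal_def]
  set c : ι → ℝ := fun i => β * L * h i ^ α with hcdef
  have hc0 : ∀ i, 0 < c i := fun i => by have := hh i; positivity
  set f : ι → Space d → ℝ := fun i => rescale φ (c i) (h i) (a i) with hf
  have hfz : ∀ i y, y ∉ Metric.closedBall (a i) (h i) → f i y = 0 := fun i y hy =>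
    rescale_eq_zero hs _ (hh i) hy
  have hfc : ∀ i y, |f i y| ≤ c i := fun i y =>
    (abs_rescale_le hφ1 _ _ _ _).trans (abs_of_pos (hc0 i)).le
  have hfε : ∀ i y, |f i y| ≤ ε * p₀ y := by
    intro i y
    by_cases hy : y ∈ Metric.closedBall (a i) (h i)
    · refine (hfc i y).trans ((hamp i).trans ?_)
      have := hcmp i y hy
      calc ε / 4 * p₀ (a i) ≤ ε / 4 * (4 * p₀ y) := by gcongr
        _ = ε * p₀ y := by ring
    · rw [hfz i y hy, abs_zero]
      exact mul_nonneg hε0 (hnn y)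
  have huniq : ∀ i j y, y ∈ Metric.closedBall (a i) (h i) → i ≠ j → f j y = 0 := by
    intro i j y hy hij
    exact hfz j y fun hyj => Set.disjoint_left.1 (hdisj hij) hy hyj
  -- at each point, at most one bump contributes to a signed sum
  have hsum : ∀ (e : ι → Bool) i y, y ∈ Metric.closedBall (a i) (h i) →
      ∑ j, sgn (e j) * f j y = sgn (e i) * f i y := by
    intro e i y hy
    refine Finset.sum_eq_single_of_mem i (Finset.mem_univ i) fun j _ hji => ?_
    rw [huniq i j y hy hji.symm, mul_zero]
  have hsumε : ∀ (e : ι → Bool) y, |∑ j, sgn (e j) * f j y| ≤ ε * p₀ y := by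
    intro e y
    by_cases hy : ∃ i, y ∈ Metric.closedBall (a i) (h i)
    · obtain ⟨i, hi⟩ := hy
      rw [hsum e i y hi, abs_mul, abs_sgn, one_mul]
      exact hfε i y
    · push Not at hy
      rw [Finset.sum_eq_zero fun i _ => by rw [hfz i y (hy i), mul_zero], abs_zero]
      exact mul_nonneg hε0 (hnn y)
  have hεp : ∀ y, ε * p₀ y ≤ p₀ y := fun y => mul_le_of_le_one_left (hnn y) hε1
  have hfsm : ∀ i, ContDiff ℝ (⊤ : ℕ∞) (f i) := fun i => contDiff_rescale hφ _ _ _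
  have hfi : ∀ i, Integrable (f i) := fun i => integrable_rescale hφ hs _ (hh i) _
  have hf0 : ∀ i, ∫ x, f i x = 0 := fun i => integral_rescale hφ0 _ _ _
  refine le_minimaxRisk (f := f) (a := fun i => 4 * (c i) ^ 2 / p₀ (a i) * (h i ^ d * V))
    hcont.measurable hnn hp.2.1 (fun i => (hfsm i).continuous.measurable)
    (fun i x => (hfε i x).trans (hεp x)) hf0 ?_ (fun e x => (hsumε e x).trans (hεp x)) ?_ hτ hchi
    fun e => ⟨?_, ?_⟩
  · intro i j hij x
    by_cases hx : x ∈ Metric.closedBall (a i) (h i)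
    · rw [huniq i j x hx hij, mul_zero]
    · rw [hfz i x hx, zero_mul]
  · intro i
    have hbd : ∀ x, p₀ x * (f i x / p₀ x) ^ 2
        ≤ (Metric.closedBall (a i) (h i)).indicator (fun _ => 4 * (c i) ^ 2 / p₀ (a i)) x := by
      intro x
      by_cases hx : x ∈ Metric.closedBall (a i) (h i)
      · rw [indicator_of_mem hx]
        have h1 := hcmp i x hx
        have h2 := hpa i
        have hpx : 0 < p₀ x := by linarith
        have h3 : (f i x) ^ 2 ≤ (c i) ^ 2 := sq_le_sq' (abs_le.1 (hfc i x)).1 (abs_le.1 (hfc i x)).2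
        calc p₀ x * (f i x / p₀ x) ^ 2 = (f i x) ^ 2 / p₀ x := by field_simp
          _ ≤ (c i) ^ 2 / (p₀ (a i) / 4) := by gcongr; linarith
          _ = 4 * (c i) ^ 2 / p₀ (a i) := by field_simp
      · rw [indicator_of_notMem hx, hfz i x hx]
        simp
    have hii : Integrable ((Metric.closedBall (a i) (h i)).indicator
        fun _ : Space d => 4 * (c i) ^ 2 / p₀ (a i)) :=
      (integrable_indicator_iff Metric.isClosed_closedBall.measurableSet).2
        (integrableOn_const (hs := measure_closedBall_lt_top.ne))
    refine (integral_mono_of_nonneg (Filter.Eventually.of_forall fun x =>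
      mul_nonneg (hnn x) (sq_nonneg _)) hii (Filter.Eventually.of_forall hbd)).trans
      (le_of_eq ?_)
    rw [integral_indicator_const _ Metric.isClosed_closedBall.measurableSet, hvol _ _ (hh i).le,
      smul_eq_mul, mul_comm]
  · -- the signed sum is itself a sum of rescaled bumps with signed amplitudes
    have hFe : (fun x => ∑ i, sgn (e i) * f i x)
        = fun x => ∑ i, rescale φ (sgn (e i) * c i) (h i) (a i) x := by
      ext x
      refine Finset.sum_congr rfl fun i _ => ?_
      simp only [hf, rescale, mul_assoc]
    refine add_mem_densityClass hc hc' hL hp ?_ ?_ ?_ (hsumε e) ?_ hε0 hε1 hεδ hεc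
    · exact ContDiff.sum fun i _ => contDiff_const.mul (hfsm i)
    · exact integrable_finsetSum _ fun i _ => (hfi i).const_mul _
    · rw [integral_finsetSum _ fun i _ => (hfi i).const_mul _]
      simp [integral_const_mul, hf0]
    · intro x y
      have hb := abs_sum_rescale_sub_taylorPoly_le (A := β * L) hφ hs hK0 (by positivity) hK
        Finset.univ (fun i => sgn (e i) * c i) h a (fun i _ => hh i)
        (fun i _ j _ hij => hdisj hij)
        (fun i _ => by rw [abs_mul, abs_sgn, one_mul, abs_of_pos (hc0 i)]) x y
      have hFy : ∑ i, sgn (e i) * f i y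
          = ∑ i, rescale φ (sgn (e i) * c i) (h i) (a i) y := congrFun hFe y
      rw [hFe, hFy]
      refine hb.trans ?_
      have hD : 0 ≤ ‖x - y‖ ^ α := Real.rpow_nonneg (norm_nonneg _) _
      calc 2 * (β * L * K) * ‖x - y‖ ^ α = (2 * β * K) * (L * ‖x - y‖ ^ α) := by ring
        _ ≤ δ * (L * ‖x - y‖ ^ α) := by gcongr
        _ = _ := by ring
  · have ht0 : 0 < t := by linarith
    have hFeq : (fun x => p₀ x + ∑ i, sgn (e i) * f i x - p₀ x)
        = fun x => ∑ i, sgn (e i) * f i x := by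
      ext x; ring
    rw [hFeq, eLpNorm_eq_lintegral_rpow_enorm_toReal (by simpa using ht0) ENNReal.ofReal_ne_top,
      ENNReal.toReal_ofReal ht0.le, one_div, ENNReal.le_rpow_inv_iff ht0,
      ENNReal.ofReal_rpow_of_nonneg hρ0 ht0.le]
    refine (ENNReal.ofReal_le_ofReal hρ).trans ?_
    have hball : ∀ i, ENNReal.ofReal ((c i * q) ^ t * ((h i * w) ^ d * V))
        ≤ ∫⁻ x in Metric.closedBall (a i) (h i), ‖∑ j, sgn (e j) * f j x‖ₑ ^ t := by
      intro i
      have hhi := hh i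
      have hci := hc0 i
      have hsub : ∀ x ∈ Metric.ball (a i + h i • v) (h i * w),
          (h i)⁻¹ • (x - a i) ∈ Metric.ball v w := by
        intro x hx
        rw [mem_ball_iff_norm] at hx ⊢
        have : (h i)⁻¹ • (x - a i) - v = (h i)⁻¹ • (x - (a i + h i • v)) := by
          rw [← sub_sub, smul_sub (h i)⁻¹ (x - a i), smul_smul, inv_mul_cancel₀ hhi.ne', one_smul]
        rw [this, norm_smul, norm_inv, Real.norm_eq_abs, abs_of_pos hhi, inv_mul_lt_iff₀ hhi]
        exact hx
      have hlow : ∀ x ∈ Metric.ball (a i + h i • v) (h i * w), c i * q ≤ |f i x| := by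
        intro x hx
        simp only [hf, rescale, abs_mul, abs_of_pos hci]
        exact mul_le_mul_of_nonneg_left (hv _ (hsub x hx)) hci.le
      have hmem : Metric.ball (a i + h i • v) (h i * w) ⊆ Metric.closedBall (a i) (h i) := by
        intro x hx
        by_contra hx'
        have h1 := hlow x hx
        rw [hfz i x hx', abs_zero] at h1
        have : 0 < c i * q := by positivity
        linarith
      calc ENNReal.ofReal ((c i * q) ^ t * ((h i * w) ^ d * V))
          = ∫⁻ _ in Metric.ball (a i + h i • v) (h i * w), ENNReal.ofReal ((c i * q) ^ t) := by
            rw [setLIntegral_const, Measure.addHaar_ball_of_pos _ _ (by positivity),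
              finrank_euclideanSpace_fin, ENNReal.ofReal_mul (by positivity),
              ENNReal.ofReal_mul (by positivity), hV, ofReal_measureReal]
        _ ≤ ∫⁻ x in Metric.ball (a i + h i • v) (h i * w), ‖∑ j, sgn (e j) * f j x‖ₑ ^ t := by
            refine setLIntegral_mono' measurableSet_ball fun x hx => ?_
            rw [hsum e i x (hmem hx), Real.enorm_eq_ofReal_abs, abs_mul, abs_sgn, one_mul,
              ENNReal.ofReal_rpow_of_nonneg (abs_nonneg _) ht0.le]
            exact ENNReal.ofReal_le_ofReal
              (Real.rpow_le_rpow (by positivity) (hlow x hx) ht0.le)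
        _ ≤ _ := lintegral_mono_set hmem
    calc ENNReal.ofReal (∑ i, (c i * q) ^ t * ((h i * w) ^ d * V))
        = ∑ i, ENNReal.ofReal ((c i * q) ^ t * ((h i * w) ^ d * V)) :=
          ENNReal.ofReal_sum_of_nonneg fun i _ => by
            have := hc0 i
            have := hh i
            have : 0 ≤ V := measureReal_nonneg
            positivity
      _ ≤ ∑ i, ∫⁻ x in Metric.closedBall (a i) (h i), ‖∑ j, sgn (e j) * f j x‖ₑ ^ t :=
          Finset.sum_le_sum fun i _ => hball i
      _ = ∫⁻ x in ⋃ i, Metric.closedBall (a i) (h i), ‖∑ j, sgn (e j) * f j x‖ₑ ^ t := by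
          rw [lintegral_iUnion (fun i => Metric.isClosed_closedBall.measurableSet) hdisj,
            tsum_fintype]
      _ ≤ _ := setLIntegral_le_lintegral _ _

/-! ### Disjoint balls that carry the bulk -/

lemma bddAbove_of_mem_densityClass {d : ℕ} {α L c : ℝ} (hα : 0 < α) (hL : 0 < L)
    (hc' : c < 1 / 2) {p : Space d → ℝ} (hp : p ∈ densityClass d α L c) :
    ∃ M : ℝ, ∀ x, p x ≤ M := by
  set V := (volume : Measure (Space d)).real (Metric.ball 0 1) with hV
  have hV0 : 0 < V := ENNReal.toReal_pos (Metric.measure_ball_pos _ _ one_pos).ne'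
    measure_ball_lt_top.ne
  refine ⟨2 * (1 / V + L), fun x => ?_⟩
  have hlow : ∀ y ∈ Metric.ball x 1, p x / 2 - L ≤ p y := by
    intro y hy
    have h1 := (abs_le.1 (hp.2.2.2 x y)).2
    have h2 : ‖x - y‖ ^ α ≤ 1 := by
      rw [mem_ball_iff_norm, norm_sub_rev] at hy
      exact Real.rpow_le_one (norm_nonneg _) hy.le hα.le
    have h3 := hp.2.2.1 x
    nlinarith
  have hint : ∫ y in Metric.ball x 1, (p x / 2 - L) ≤ ∫ y in Metric.ball x 1, p y :=
    setIntegral_mono_on (integrableOn_const (hs := measure_ball_lt_top.ne))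
      (integrable_of_mem_densityClass hp).integrableOn measurableSet_ball hlow
  have hle : ∫ y in Metric.ball x 1, p y ≤ 1 := by
    rw [← hp.2.1]
    exact setIntegral_le_integral (integrable_of_mem_densityClass hp)
      (Filter.Eventually.of_forall hp.2.2.1)
  have hvol : (volume : Measure (Space d)).real (Metric.ball x 1) = V := by
    rw [hV, measureReal_def, measureReal_def, Measure.addHaar_ball_center]
  rw [setIntegral_const, hvol, smul_eq_mul] at hint
  have : p x / 2 - L ≤ 1 / V := by
    rw [le_div_iff₀ hV0]
    linarith
  linarith

/-- Vitali's covering lemma, in the form used here: finitely many disjoint balls centred in `B`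
whose enlargements carry half of `∫_B p ^ r`. -/
lemma exists_finset_disjoint_closedBall {d : ℕ} {p h : Space d → ℝ} {r R : ℝ} (hr : 0 ≤ r)
    (hp : ∀ x, 0 ≤ p x) {B : Set (Space d)} (hh : ∀ x ∈ B, 0 < h x) (hR : ∀ x ∈ B, h x ≤ R)
    (hcmp : ∀ x ∈ B, ∀ y ∈ Metric.closedBall x (5 * h x), p y ≤ 2 * p x)
    (h0 : mass (fun x => p x ^ r) B ≠ 0) (htop : mass (fun x => p x ^ r) B ≠ ⊤) :
    ∃ s : Finset (Space d), (∀ x ∈ s, x ∈ B) ∧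
      ((s : Set (Space d)).PairwiseDisjoint fun x => Metric.closedBall x (h x)) ∧
      (mass (fun x => p x ^ r) B).toReal
        ≤ 2 * (2 ^ r * 5 ^ d * (volume : Measure (Space d)).real (Metric.ball 0 1))
          * ∑ x ∈ s, p x ^ r * h x ^ d := by
  classical
  obtain ⟨u, huB, hdisj, hcov⟩ :=
    Vitali.exists_disjoint_subfamily_covering_enlargement_closedBall B id h R hR 5 (by norm_num)
  simp only [id] at hdisj hcov
  have hcount : u.Countable := by
    refine hdisj.countable_of_nonempty_interior fun x hx => ?_
    refine ⟨x, ?_⟩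
    exact Metric.ball_subset_interior_closedBall (Metric.mem_ball_self (hh x (huB hx)))
  have : Countable u := hcount.to_subtype
  set V := (volume : Measure (Space d)).real (Metric.ball 0 1) with hV
  have hBsub : B ⊆ ⋃ x : u, Metric.closedBall (x : Space d) (5 * h x) := by
    intro x hx
    obtain ⟨b, hb, hxb⟩ := hcov x hx
    exact mem_iUnion.2 ⟨⟨b, hb⟩, hxb (Metric.mem_closedBall_self (hh x hx).le)⟩
  set W : ℝ := 2 ^ r * 5 ^ d * V with hW
  have hV0 : 0 ≤ V := measureReal_nonneg
  have hW0 : 0 ≤ W := by positivity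
  have hterm : ∀ x : u, ∫⁻ y in Metric.closedBall (x : Space d) (5 * h x), ENNReal.ofReal (p y ^ r)
      ≤ ENNReal.ofReal (W * (p x ^ r * h x ^ d)) := by
    intro x
    have hx := huB x.2
    have hhx := hh x hx
    have hpx := hp x
    calc ∫⁻ y in Metric.closedBall (x : Space d) (5 * h x), ENNReal.ofReal (p y ^ r)
        ≤ ∫⁻ _ in Metric.closedBall (x : Space d) (5 * h x), ENNReal.ofReal ((2 * p x) ^ r) := by
          refine setLIntegral_mono' Metric.isClosed_closedBall.measurableSet fun y hy => ?_
          exact ENNReal.ofReal_le_ofReal (Real.rpow_le_rpow (hp y) (hcmp x hx y hy) hr)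
      _ = ENNReal.ofReal (W * (p x ^ r * h x ^ d)) := by
          rw [setLIntegral_const, Measure.addHaar_closedBall _ _ (by positivity),
            finrank_euclideanSpace_fin, ← ofReal_measureReal (μ := volume) (s := Metric.ball 0 1),
            ← ENNReal.ofReal_mul (by positivity), ← ENNReal.ofReal_mul (by positivity), ← hV, hW,
            Real.mul_rpow (by norm_num) hpx, mul_pow]
          congr 1
          ring
  have htsum : mass (fun x => p x ^ r) B
      ≤ ∑' x : u, ENNReal.ofReal (W * (p x ^ r * h x ^ d)) :=
    (lintegral_mono_set hBsub).trans ((lintegral_iUnion_le _ _).trans (ENNReal.tsum_le_tsum hterm))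
  have hhalf : mass (fun x => p x ^ r) B / 2
      < ⨆ s : Finset u, ∑ x ∈ s, ENNReal.ofReal (W * (p x ^ r * h x ^ d)) := by
    rw [← ENNReal.tsum_eq_iSup_sum]
    exact (ENNReal.half_lt_self h0 htop).trans_le htsum
  obtain ⟨s, hs⟩ := lt_iSup_iff.1 hhalf
  refine ⟨s.map (Function.Embedding.subtype _), fun x hx => ?_, ?_, ?_⟩
  · obtain ⟨y, -, rfl⟩ := Finset.mem_map.1 hx
    exact huB y.2
  · refine hdisj.subset fun x hx => ?_
    obtain ⟨y, -, rfl⟩ := Finset.mem_map.1 (Finset.mem_coe.1 hx)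
    exact y.2
  · rw [Finset.sum_map]
    have hnn : ∀ x ∈ s, 0 ≤ W * (p x ^ r * h x ^ d) := fun x _ => by
      have := hp x
      have := hh x (huB x.2)
      positivity
    rw [← ENNReal.ofReal_sum_of_nonneg hnn] at hs
    have h2 := ENNReal.toReal_mono ENNReal.ofReal_ne_top hs.le
    rw [ENNReal.toReal_ofReal (Finset.sum_nonneg hnn), ENNReal.toReal_div,
      ← Finset.mul_sum] at h2
    simp only [ENNReal.toReal_ofNat] at h2
    simp only [Function.Embedding.subtype_apply]
    linarith

/-! ### The auxiliary cut-off -/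

lemma mass_le_one {d : ℕ} {α L c : ℝ} {p : Space d → ℝ} (hp : p ∈ densityClass d α L c)
    (A : Set (Space d)) : mass p A ≤ 1 := by
  refine (setLIntegral_le_lintegral _ _).trans ?_
  rw [← ofReal_integral_eq_lintegral_ofReal (integrable_of_mem_densityClass hp)
    (Filter.Eventually.of_forall hp.2.2.1), hp.2.1, ENNReal.ofReal_one]

lemma mass_sq_tail_le {d : ℕ} {p : Space d → ℝ} (hpm : Measurable p) (hp0 : ∀ x, 0 ≤ p x)
    (u : ℝ≥0) : mass (fun x => p x ^ 2) (tail p u) ≤ u * mass p (tail p u) := by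
  have hms : MeasurableSet (tail p u) := measurableSet_lt hpm.ennreal_ofReal measurable_const
  rw [mass, mass, ← lintegral_const_mul _ hpm.ennreal_ofReal]
  refine setLIntegral_mono' hms fun x hx => ?_
  rw [sq, ENNReal.ofReal_mul (hp0 x)]
  exact mul_le_mul_left (le_of_lt hx) _

/-- Above the cut-off `uAux` the defining inequality is reversed; together with
`p²[T(u)] ≤ u p[T(u)]` this bounds `uAux` from below by a power of the mass of any tail `T(w)`
with `w > uAux`. -/
lemma le_uAux_mul_rpow {d : ℕ} (hd : 1 ≤ d) {α L c cAux : ℝ} (hα : 0 < α) (hL : 0 < L)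
    (hcAux : 0 < cAux) {n : ℕ} (hn : 1 ≤ n) {p : Space d → ℝ} (hp : p ∈ densityClass d α L c)
    {w : ℝ≥0∞} (hw : uAux α L cAux n p < w) :
    cAux * Ltilde d α L n ^ (1 / (α + d))
      ≤ (uAux α L cAux n p).toReal * (mass p (tail p w)).toReal ^ (α / (α + d)) := by
  have hd0 : (0 : ℝ) < d := by exact_mod_cast hd
  have hn0 : (0 : ℝ) < n := by exact_mod_cast hn
  have hLt : 0 < Ltilde d α L n := by unfold Ltilde; positivity
  have hpm := (continuous_of_mem_densityClass hα hp).measurable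
  set A := cAux * Ltilde d α L n ^ (1 / (α + d)) with hA
  have hA0 : 0 < A := by positivity
  set P := (mass p (tail p w)).toReal with hP
  have hfin : ∀ S, mass p S ≠ ⊤ := fun S => ((mass_le_one hp S).trans_lt ENNReal.one_lt_top).ne
  have key : ∀ u : ℝ≥0, uAux α L cAux n p < u → (u : ℝ≥0∞) ≤ w →
      A ≤ u * P ^ (α / (α + d)) := by
    intro u hu huw
    set m := mass p (tail p u) with hm
    have h1 : ¬ mass (fun x => p x ^ 2) (tail p u) / m ^ ((d : ℝ) / (α + d)) ≤ ENNReal.ofReal A :=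
      fun h => hu.not_ge (le_iSup₂ (f := fun (v : ℝ≥0) (_ : mass (fun x => p x ^ 2) (tail p v)
        / mass p (tail p v) ^ ((d : ℝ) / (α + d)) ≤ ENNReal.ofReal A) => (v : ℝ≥0∞)) u h)
    have hsq := mass_sq_tail_le hpm hp.2.2.1 u
    -- a tail of mass zero would satisfy the defining inequality of `uAux`, since `0 / 0 = 0`
    have hm0 : m ≠ 0 := by
      intro h0
      refine h1 ?_
      rw [← hm, h0, mul_zero] at hsq
      rw [le_antisymm hsq (zero_le), ENNReal.zero_div]
      exact zero_le
    have h2 : ENNReal.ofReal A * m ^ ((d : ℝ) / (α + d)) ≤ u * m :=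
      (ENNReal.mul_le_of_le_div (not_le.1 h1).le).trans hsq
    have hmr : 0 < m.toReal := ENNReal.toReal_pos hm0 (hfin _)
    have h3 : A * m.toReal ^ ((d : ℝ) / (α + d)) ≤ u * m.toReal := by
      have := ENNReal.toReal_mono (ENNReal.mul_ne_top ENNReal.coe_ne_top (hfin _)) h2
      rwa [ENNReal.toReal_mul, ENNReal.toReal_mul, ENNReal.toReal_ofReal hA0.le,
        ← ENNReal.toReal_rpow, ENNReal.coe_toReal] at this
    have hmP : m.toReal ≤ P := ENNReal.toReal_mono (hfin _)
      (lintegral_mono_set fun x hx => lt_of_lt_of_le hx huw)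
    have h4 : m.toReal = m.toReal ^ (α / (α + d)) * m.toReal ^ ((d : ℝ) / (α + d)) := by
      rw [← Real.rpow_add hmr, ← add_div, div_self (by positivity), Real.rpow_one]
    have h5 : A ≤ u * m.toReal ^ (α / (α + d)) := by
      have h6 : 0 < m.toReal ^ ((d : ℝ) / (α + d)) := Real.rpow_pos_of_pos hmr _
      refine le_of_mul_le_mul_right ?_ h6
      calc A * m.toReal ^ ((d : ℝ) / (α + d)) ≤ u * m.toReal := h3
        _ = u * m.toReal ^ (α / (α + d)) * m.toReal ^ ((d : ℝ) / (α + d)) := by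
          rw [mul_assoc, ← h4]
    exact h5.trans (by gcongr)
  have hu0 : uAux α L cAux n p ≠ ⊤ := hw.ne_top
  -- let `u` decrease to `uAux`
  have hP0 : 0 ≤ P ^ (α / (α + d)) := Real.rpow_nonneg ENNReal.toReal_nonneg _
  obtain ⟨v, hv1, hv2⟩ := ENNReal.lt_iff_exists_nnreal_btwn.1 hw
  set a : ℝ := (uAux α L cAux n p).toReal with ha
  have hav : a < v := by
    have := (ENNReal.toReal_lt_toReal hu0 ENNReal.coe_ne_top).2 hv1
    simpa using this
  have hlim : ∀ s ∈ Ioo a v, A ≤ s * P ^ (α / (α + d)) := by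
    intro s hs
    have hs0 : 0 ≤ s := ENNReal.toReal_nonneg.trans hs.1.le
    have hsN : ((s.toNNReal : ℝ≥0) : ℝ) = s := Real.coe_toNNReal s hs0
    have h1 : uAux α L cAux n p < (s.toNNReal : ℝ≥0) := by
      rw [← ENNReal.ofReal_toReal hu0]
      exact (ENNReal.ofReal_lt_ofReal_iff_of_nonneg ENNReal.toReal_nonneg).2 hs.1
    have h2 : ((s.toNNReal : ℝ≥0) : ℝ≥0∞) ≤ w := by
      refine le_trans ?_ hv2.le
      exact ENNReal.coe_le_coe.2 (Real.toNNReal_le_iff_le_coe.2 hs.2.le)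
    have h3 := key _ h1 h2
    rwa [hsN] at h3
  have hcl : a ∈ closure (Ioo a (v : ℝ)) := by
    rw [closure_Ioo hav.ne]
    exact left_mem_Icc.2 hav.le
  have hclosed : IsClosed {s : ℝ | A ≤ s * P ^ (α / (α + d))} :=
    isClosed_le continuous_const (continuous_id.mul continuous_const)
  exact closure_minimal (fun s hs => hlim s hs) hclosed hcl

lemma uAux_pos {d : ℕ} (hd : 1 ≤ d) {α L c cAux : ℝ} (hα : 0 < α) (hL : 0 < L)
    (hcAux : 0 < cAux) {n : ℕ} (hn : 1 ≤ n) {p : Space d → ℝ} (hp : p ∈ densityClass d α L c) :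
    0 < uAux α L cAux n p := by
  by_contra h
  have h0 : uAux α L cAux n p = 0 := le_antisymm (not_lt.1 h) zero_le
  have hw : uAux α L cAux n p < ⊤ := by rw [h0]; exact ENNReal.zero_lt_top
  have h1 := le_uAux_mul_rpow hd hα hL hcAux hn hp hw
  have hn0 : (0 : ℝ) < n := by exact_mod_cast hn
  have hLt : 0 < Ltilde d α L n := by unfold Ltilde; positivity
  rw [h0, ENNReal.toReal_zero, zero_mul] at h1
  have : 0 < cAux * Ltilde d α L n ^ (1 / (α + d)) := by positivity
  linarith

/-- The natural size `L ^ (d / (4α + d)) / (n² I) ^ (α / (4α + d))` of a bump at a point where the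
density is `1`. -/
noncomputable def bumpScale (d : ℕ) (α L : ℝ) (n : ℕ) (I : ℝ) : ℝ :=
  L ^ ((d : ℝ) / (4 * α + d)) / ((n : ℝ) ^ 2 * I) ^ (α / (4 * α + d))

lemma bumpScale_pos {d n : ℕ} {α L I : ℝ} (hL : 0 < L) (hn : 1 ≤ n) (hI : 0 < I) :
    0 < bumpScale d α L n I := by
  have hn0 : (0 : ℝ) < n := by exact_mod_cast hn
  unfold bumpScale
  positivity

lemma log_Ltilde {d n : ℕ} {α L : ℝ} (hL : 0 < L) (hn : 1 ≤ n) :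
    Real.log (Ltilde d α L n) = d * Real.log L - 2 * α * Real.log n := by
  have hn0 : (0 : ℝ) < n := by exact_mod_cast hn
  rw [Ltilde, Real.log_div (by positivity) (by positivity), Real.log_pow, Real.log_rpow hn0]

lemma log_bumpScale {d n : ℕ} {α L I : ℝ} (hL : 0 < L) (hn : 1 ≤ n) (hI : 0 < I) :
    Real.log (bumpScale d α L n I)
      = (Real.log (Ltilde d α L n) - α * Real.log I) / (4 * α + d) := by
  have hn0 : (0 : ℝ) < n := by exact_mod_cast hn
  rw [bumpScale, Real.log_div (by positivity) (by positivity), Real.log_rpow hL,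
    Real.log_rpow (by positivity), Real.log_mul (by positivity) hI.ne', Real.log_pow,
    log_Ltilde hL hn]
  push_cast
  ring

lemma rhoBulk_eq {d : ℕ} (hd : 1 ≤ d) {α L t cAux : ℝ} (hα : 0 < α)
    (ht : t ∈ Icc (1 : ℝ) 2) {n : ℕ} {p : Space d → ℝ} (hp0 : ∀ x, 0 ≤ p x)
    (hpm : Measurable p) :
    rhoBulk α L t cAux n p = (ENNReal.ofReal (Ltilde d α L n)
      * bulkIntegral α L t cAux n p ^ (((4 - t) * α + d) / t)) ^ (1 / (4 * α + d)) := by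
  have hd0 : (0 : ℝ) < d := by exact_mod_cast hd
  have ht0 : 0 < t := by linarith [ht.1]
  have hE : 0 < (4 - t) * α + d := by nlinarith [ht.2]
  have hr : 0 < rExp d α t := by unfold rExp; positivity
  have hms : MeasurableSet (bulk p (uAux α L cAux n p)) :=
    measurableSet_le measurable_const hpm.ennreal_ofReal
  rw [rhoBulk, eLpNorm_eq_lintegral_rpow_enorm_toReal (by simpa using hr) ENNReal.ofReal_ne_top,
    ENNReal.toReal_ofReal hr.le, bulkIntegral, mass, ← ENNReal.rpow_mul]
  congr 3
  · rw [← lintegral_indicator hms]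
    refine lintegral_congr fun x => ?_
    by_cases hx : x ∈ bulk p (uAux α L cAux n p)
    · rw [indicator_of_mem hx, indicator_of_mem hx, Real.enorm_eq_ofReal (hp0 x),
        ENNReal.ofReal_rpow_of_nonneg (hp0 x) hr.le]
    · rw [indicator_of_notMem hx, indicator_of_notMem hx, enorm_zero, ENNReal.zero_rpow_of_pos hr]
  · unfold rExp
    field_simp

/-- **When the bulk dominates, `uAux` is at least a constant times the second cut-off in the
maximum that defines `uB`**; both sides are stated after raising to the power that turns this
cut-off into a multiple of the bump scale. If `uB > uAux`, the dominance bounds the mass of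
`T(uB)` from above, and hence `uAux` from below by `le_uAux_mul_rpow`; the exponents match exactly.
If `uB = uAux`, the claim is the definition of `uB`. -/
lemma exists_mul_bumpScale_le_uAux {d : ℕ} (hd : 1 ≤ d) {α t cAux cB CBT : ℝ} (hα : 0 < α)
    (ht : t ∈ Icc (1 : ℝ) 2) (hcAux : 0 < cAux) (hcB : 0 < cB) (hCBT : 0 < CBT) :
    ∃ k : ℝ, 0 < k ∧ ∀ (L c : ℝ) (n : ℕ) (p : Space d → ℝ), 0 < L → 1 ≤ n →
      p ∈ densityClass d α L c → BulkDominates α L t cAux cB CBT n p →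
      uAux α L cAux n p ≠ ⊤ → bulkIntegral α L t cAux n p ≠ 0 →
      bulkIntegral α L t cAux n p ≠ ⊤ →
      k * bumpScale d α L n (bulkIntegral α L t cAux n p).toReal
        ≤ (uAux α L cAux n p).toReal ^ (((2 - t) * α + d) / ((4 - t) * α + d)) := by
  have hd0 : (0 : ℝ) < d := by exact_mod_cast hd
  have ht0 : 0 < t := by linarith [ht.1]
  set E := (4 - t) * α + d with hE
  set G := (2 - t) * α + d with hG
  have hE0 : 0 < E := by nlinarith [ht.2]
  have hG0 : 0 < G := by nlinarith [ht.2]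
  set k₁ := Real.exp (G / E * Real.log cAux - α * t / E * Real.log CBT) with hk₁
  refine ⟨min cB k₁, lt_min hcB (Real.exp_pos _), ?_⟩
  intro L c n p hL hn hp hBD hu hI0 hItop
  have hn0 : (0 : ℝ) < n := by exact_mod_cast hn
  have hpm := (continuous_of_mem_densityClass hα hp).measurable
  have hLt : 0 < Ltilde d α L n := by unfold Ltilde; positivity
  set I := (bulkIntegral α L t cAux n p).toReal with hI
  have hIpos : 0 < I := ENNReal.toReal_pos hI0 hItop
  have hIE : bulkIntegral α L t cAux n p = ENNReal.ofReal I := (ENNReal.ofReal_toReal hItop).symm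
  set q := bumpScale d α L n I with hq
  have hq0 : 0 < q := bumpScale_pos hL hn hIpos
  set a := (uAux α L cAux n p).toReal with ha
  have ha0 : 0 < a := ENNReal.toReal_pos (uAux_pos hd hα hL hcAux hn hp).ne' hu
  have huB : uB α L t cAux cB n p
      = max (uAux α L cAux n p) (ENNReal.ofReal ((cB * q) ^ (E / G))) := by
    rw [uB, hIE, ← hE, ← hG]
    congr 1
    rw [← ENNReal.ofReal_natCast n, ← ENNReal.ofReal_pow (by positivity),
      ← ENNReal.ofReal_mul (by positivity), ENNReal.ofReal_rpow_of_pos (by positivity),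
      ← ENNReal.ofReal_div_of_pos (by positivity), ENNReal.ofReal_rpow_of_pos (by positivity), hq,
      bumpScale, mul_div_assoc]
  rcases le_or_gt (uB α L t cAux cB n p) (uAux α L cAux n p) with hle | hlt
  · rw [huB] at hle
    have h1 := ENNReal.toReal_mono hu ((le_max_right _ _).trans hle)
    rw [ENNReal.toReal_ofReal (by positivity)] at h1
    calc min cB k₁ * q ≤ cB * q := by gcongr; exact min_le_left _ _
      _ = ((cB * q) ^ (E / G)) ^ (G / E) := by
        rw [← Real.rpow_mul (by positivity), div_mul_div_cancel₀ hG0.ne', div_self hE0.ne',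
          Real.rpow_one]
      _ ≤ a ^ (G / E) := by gcongr
  · have hA := le_uAux_mul_rpow hd hα hL hcAux hn hp hlt
    rw [← ha] at hA
    set P := (mass p (tail p (uB α L t cAux cB n p))).toReal with hP
    have hPtop : mass p (tail p (uB α L t cAux cB n p)) ≠ ⊤ :=
      ((mass_le_one hp _).trans_lt ENNReal.one_lt_top).ne
    have hP0 : 0 < P := by
      refine lt_of_le_of_ne ENNReal.toReal_nonneg fun h0 => ?_
      rw [← h0, Real.zero_rpow (by positivity), mul_zero] at hA
      have : 0 < cAux * Ltilde d α L n ^ (1 / (α + d)) := by positivity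
      linarith
    have hdom : (Ltilde d α L n ^ (t - 1) * P ^ G) ^ (1 / (t * (α + d)))
        ≤ CBT * (Ltilde d α L n * I ^ (E / t)) ^ (1 / (4 * α + d)) := by
      have h := hBD
      rw [BulkDominates, rhoTail, rhoBulk_eq hd hα ht hp.2.2.1 hpm, hIE, ← hG, ← hE,
        ← ENNReal.ofReal_toReal hPtop, ← hP, ENNReal.ofReal_rpow_of_pos hP0,
        ENNReal.ofReal_rpow_of_pos hIpos, ← ENNReal.ofReal_mul (by positivity),
        ← ENNReal.ofReal_mul (by positivity), ENNReal.ofReal_rpow_of_pos (by positivity),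
        ENNReal.ofReal_rpow_of_pos (by positivity), ← ENNReal.ofReal_mul (by positivity),
        ENNReal.ofReal_le_ofReal_iff (by positivity)] at h
      exact h
    have hdomL := Real.log_le_log (by positivity) hdom
    rw [Real.log_rpow (by positivity), Real.log_mul (by positivity) (by positivity),
      Real.log_rpow hLt, Real.log_rpow hP0, Real.log_mul (by positivity) (by positivity),
      Real.log_rpow (by positivity), Real.log_mul (by positivity) (by positivity),
      Real.log_rpow hIpos] at hdomL
    have hAL := Real.log_le_log (by positivity) hA
    rw [Real.log_mul (by positivity) (by positivity), Real.log_rpow hLt,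
      Real.log_mul (by positivity) (by positivity), Real.log_rpow hP0] at hAL
    -- in logarithms both bounds are linear, and eliminating `log P` leaves the claim
    have hgoal : Real.log (k₁ * q) ≤ Real.log (a ^ (G / E)) := by
      rw [Real.log_mul (Real.exp_pos _).ne' hq0.ne', Real.log_rpow ha0, Real.log_exp, hq,
        log_bumpScale hL hn hIpos]
      set l := Real.log (Ltilde d α L n)
      set i := Real.log I
      have h1 : G / E * (Real.log cAux + 1 / (α + d) * l)
          ≤ G / E * (Real.log a + α / (α + d) * Real.log P) :=
        mul_le_mul_of_nonneg_left hAL (by positivity)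
      have h2 : α * t / E * (1 / (t * (α + d)) * ((t - 1) * l + G * Real.log P))
          ≤ α * t / E * (Real.log CBT + 1 / (4 * α + d) * (l + E / t * i)) :=
        mul_le_mul_of_nonneg_left hdomL (by positivity)
      have e1 : G / E * (Real.log a + α / (α + d) * Real.log P) + (α * t / E
            * (Real.log CBT + 1 / (4 * α + d) * (l + E / t * i))
          - α * t / E * (1 / (t * (α + d)) * ((t - 1) * l + G * Real.log P)))
          - G / E * (Real.log cAux + 1 / (α + d) * l)
          = G / E * Real.log a - (G / E * Real.log cAux - α * t / E * Real.log CBT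
            + (l - α * i) / (4 * α + d)) := by
        have hαd : α + d ≠ 0 := by positivity
        have hD : 4 * α + d ≠ 0 := by positivity
        have hE' : E ≠ 0 := hE0.ne'
        field_simp
        rw [hG, hE]
        ring
      linarith
    have h3 := (Real.log_le_log_iff (by positivity) (by positivity)).1 hgoal
    refine le_trans ?_ h3
    gcongr
    exact min_le_right _ _

/-! ### The lower bound on the separation radius -/

lemma bulk_top {d : ℕ} (p : Space d → ℝ) : bulk p ⊤ = ∅ := by
  ext x
  simp [bulk]

lemma bulkIntegral_ne_top {d : ℕ} (hd : 1 ≤ d) {α L c t cAux : ℝ} (hα : 0 < α) (hL : 0 < L)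
    (hc' : c < 1 / 2) (ht : t ∈ Icc (1 : ℝ) 2) (hcAux : 0 < cAux) {n : ℕ} (hn : 1 ≤ n)
    {p : Space d → ℝ} (hp : p ∈ densityClass d α L c) (hu : uAux α L cAux n p ≠ ⊤) :
    bulkIntegral α L t cAux n p ≠ ⊤ := by
  have hd0 : (0 : ℝ) < d := by exact_mod_cast hd
  have ht0 : 0 < t := by linarith [ht.1]
  have hE : 0 < (4 - t) * α + d := by nlinarith [ht.2]
  have hr : 0 < rExp d α t := by unfold rExp; positivity
  have hpm := (continuous_of_mem_densityClass hα hp).measurable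
  obtain ⟨M, hM⟩ := bddAbove_of_mem_densityClass hα hL hc' hp
  set a := (uAux α L cAux n p).toReal with ha
  have ha0 : 0 < a := ENNReal.toReal_pos (uAux_pos hd hα hL hcAux hn hp).ne' hu
  have hms : MeasurableSet (bulk p (uAux α L cAux n p)) :=
    measurableSet_le measurable_const hpm.ennreal_ofReal
  -- on the bulk, `p ^ r ≤ M ^ r ≤ (M ^ r / a) p`
  have hle : bulkIntegral α L t cAux n p
      ≤ ENNReal.ofReal (M ^ rExp d α t / a) * mass p (bulk p (uAux α L cAux n p)) := by
    rw [bulkIntegral, mass, mass, ← lintegral_const_mul _ hpm.ennreal_ofReal]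
    refine setLIntegral_mono' hms fun x hx => ?_
    have hxa : a ≤ p x := (ENNReal.le_ofReal_iff_toReal_le hu (hp.2.2.1 x)).1 hx
    have hM0 : 0 ≤ M := (hp.2.2.1 x).trans (hM x)
    rw [← ENNReal.ofReal_mul (by positivity)]
    refine ENNReal.ofReal_le_ofReal ?_
    calc p x ^ rExp d α t ≤ M ^ rExp d α t :=
          Real.rpow_le_rpow (hp.2.2.1 x) (hM x) hr.le
      _ = M ^ rExp d α t / a * a := (div_mul_cancel₀ _ ha0.ne').symm
      _ ≤ M ^ rExp d α t / a * p x := by gcongr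
  exact (hle.trans_lt (ENNReal.mul_lt_top ENNReal.ofReal_lt_top
    ((mass_le_one hp _).trans_lt ENNReal.one_lt_top))).ne

/-- Bumps of bandwidth proportional to `p₀ ^ (2 / ((4 - t) α + d))`, centred in the bulk. This
choice of the bandwidth maximizes the `L_t` distance for a given chi-square cost. -/
lemma le_minimaxRisk_of_le_bumpScale {d : ℕ} (hd : 1 ≤ d)
    {α L cstar δ t ρ τ ε K q w k κ₀ θ W cAux : ℝ} {n : ℕ} {p₀ φ : Space d → ℝ} {v : Space d}
    (hα : 0 < α) (hL : 0 < L) (hn : 1 ≤ n) (ht : t ∈ Icc (1 : ℝ) 2)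
    (hc : 0 < cstar) (hc' : cstar < 1 / 2) (hcAux : 0 < cAux)
    (hp : p₀ ∈ densityClass d α L cstar)
    (hφ : ContDiff ℝ (⊤ : ℕ∞) φ) (hs : ∀ x, φ x ≠ 0 → ‖x‖ ≤ 1) (hφ1 : ∀ x, |φ x| ≤ 1)
    (hφ0 : ∫ x, φ x = 0) (hq : 0 < q) (hw : 0 < w) (hv : ∀ x ∈ Metric.ball v w, q ≤ |φ x|)
    (hK0 : 0 ≤ K)
    (hK : ∀ x y : Space d, |φ y - taylorPoly (smoothOrder α) φ x (y - x)| ≤ K * ‖x - y‖ ^ α)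
    (hε1 : ε ≤ 1) (hεδ : ε ≤ δ)
    (hεc : cstar + 3 * ε ≤ (1 + δ) * cstar * (1 - ε)) (hτ : 0 < τ)
    (hκ₀ : 0 < κ₀) (hκk : κ₀ ^ α ≤ (4 * 5 ^ α)⁻¹ * k)
    (hW : W = 2 * (2 ^ rExp d α t * 5 ^ d * (volume : Measure (Space d)).real (Metric.ball 0 1)))
    (hθ : 0 < θ) (hθε : θ ≤ ε) (hθK : 2 * θ * K ≤ δ)
    (hθτ : 16 * (volume : Measure (Space d)).real (Metric.ball 0 1) ^ 2 * θ ^ 4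
      * κ₀ ^ (4 * α + d) / W ≤ 2 * Real.log (1 + τ ^ 2))
    (hu : uAux α L cAux n p₀ ≠ ⊤) (hI0 : bulkIntegral α L t cAux n p₀ ≠ 0)
    (hku : k * bumpScale d α L n (bulkIntegral α L t cAux n p₀).toReal
        ≤ (uAux α L cAux n p₀).toReal ^ (((2 - t) * α + d) / ((4 - t) * α + d)))
    (hρ0 : 0 ≤ ρ)
    (hρ : ρ ≤ θ * q * κ₀ ^ α
      * (w ^ d * (volume : Measure (Space d)).real (Metric.ball 0 1) / W) ^ (1 / t)
      * (bumpScale d α L n (bulkIntegral α L t cAux n p₀).toReal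
        * (bulkIntegral α L t cAux n p₀).toReal ^ (1 / t))) :
    ENNReal.ofReal (1 - τ) ≤ minimaxRisk α L cstar δ t n p₀ ρ := by
  have hItop := bulkIntegral_ne_top hd hα hL hc' ht hcAux hn hp hu
  have hd0 : (0 : ℝ) < d := by exact_mod_cast hd
  have hn0 : (0 : ℝ) < n := by exact_mod_cast hn
  have ht0 : 0 < t := by linarith [ht.1]
  set E := (4 - t) * α + d with hE
  set G := (2 - t) * α + d with hG
  have hE0 : 0 < E := by nlinarith [ht.2]
  have hG0 : 0 < G := by nlinarith [ht.2]
  have hD0 : 0 < 4 * α + d := by positivity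
  have hr : rExp d α t = 2 * α * t / E := rfl
  have hr0 : 0 < rExp d α t := by rw [hr]; positivity
  set V := (volume : Measure (Space d)).real (Metric.ball 0 1) with hV
  have hV0 : 0 < V := ENNReal.toReal_pos (Metric.measure_ball_pos _ _ one_pos).ne'
    measure_ball_lt_top.ne
  have hW0 : 0 < W := by rw [hW]; positivity
  set I := (bulkIntegral α L t cAux n p₀).toReal with hI
  have hIpos : 0 < I := ENNReal.toReal_pos hI0 hItop
  set Q := bumpScale d α L n I with hQ
  have hQ0 : 0 < Q := bumpScale_pos hL hn hIpos
  set a := (uAux α L cAux n p₀).toReal with ha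
  have ha0 : 0 < a := ENNReal.toReal_pos (uAux_pos hd hα hL hcAux hn hp).ne' hu
  set B := bulk p₀ (uAux α L cAux n p₀) with hB
  have hBa : ∀ x ∈ B, a ≤ p₀ x := fun x hx =>
    (ENNReal.le_ofReal_iff_toReal_le hu (hp.2.2.1 x)).1 hx
  -- the bandwidth at a point where the density is `1`; its `(4α + d)`-th power normalizes the
  -- chi-square cost `n² L⁴ κ ^ (4α + d) I` to a constant
  set κ := κ₀ * ((n : ℝ) ^ 2 * L ^ 4 * I) ^ (-1 / (4 * α + d)) with hκ
  have hκ0 : 0 < κ := by positivity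
  have hκα : L * κ ^ α = κ₀ ^ α * Q := by
    rw [hκ, Real.mul_rpow hκ₀.le (by positivity), ← Real.rpow_mul (by positivity),
      show (n : ℝ) ^ 2 * L ^ 4 * I = L ^ 4 * ((n : ℝ) ^ 2 * I) by ring,
      Real.mul_rpow (by positivity) (by positivity), hQ, bumpScale,
      div_eq_mul_inv (L ^ ((d : ℝ) / (4 * α + d))),
      ← Real.rpow_neg (by positivity), ← Real.rpow_natCast L 4, ← Real.rpow_mul hL.le]
    have e1 : L ^ ((d : ℝ) / (4 * α + d)) = L * L ^ (((4 : ℕ) : ℝ) * (-1 / (4 * α + d) * α)) := by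
      rw [← Real.rpow_one_add' hL.le]
      · congr 1
        field_simp
        push_cast
        ring
      · have : (1 : ℝ) + ((4 : ℕ) : ℝ) * (-1 / (4 * α + d) * α) = d / (4 * α + d) := by
          field_simp
          push_cast
          ring
        rw [this]
        positivity
    rw [e1, show -(α / (4 * α + d)) = -1 / (4 * α + d) * α by ring]
    ring
  have hκD : (n : ℝ) ^ 2 * L ^ 4 * κ ^ (4 * α + d) * I = κ₀ ^ (4 * α + d) := by
    rw [hκ, Real.mul_rpow hκ₀.le (by positivity), ← Real.rpow_mul (by positivity),
      div_mul_cancel₀ _ hD0.ne', Real.rpow_neg_one]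
    field_simp
  set h : Space d → ℝ := fun x => κ * p₀ x ^ (2 / E) with hh
  have hpB : ∀ x ∈ B, 0 < p₀ x := fun x hx => ha0.trans_le (hBa x hx)
  have hhB : ∀ x ∈ B, 0 < h x := fun x hx => mul_pos hκ0 (Real.rpow_pos_of_pos (hpB x hx) _)
  have hLh : ∀ x ∈ B, L * h x ^ α = κ₀ ^ α * Q * p₀ x ^ (2 * α / E) := by
    intro x hx
    have hpx := (hpB x hx).le
    simp only [hh]
    rw [Real.mul_rpow hκ0.le (by positivity), ← mul_assoc, hκα, ← Real.rpow_mul hpx,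
      div_mul_eq_mul_div]
  -- the lower bound on `uAux` makes the bumps small compared with `p₀` on the whole bulk
  have hLhp : ∀ x ∈ B, L * h x ^ α ≤ (4 * 5 ^ α)⁻¹ * p₀ x := by
    intro x hx
    have hpx := hpB x hx
    rw [hLh x hx]
    calc κ₀ ^ α * Q * p₀ x ^ (2 * α / E)
        ≤ (4 * 5 ^ α)⁻¹ * k * Q * p₀ x ^ (2 * α / E) := by gcongr
      _ = (4 * 5 ^ α)⁻¹ * (k * Q) * p₀ x ^ (2 * α / E) := by ring
      _ ≤ (4 * 5 ^ α)⁻¹ * (p₀ x ^ (G / E)) * p₀ x ^ (2 * α / E) := by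
          gcongr
          exact hku.trans (Real.rpow_le_rpow ha0.le (hBa x hx) (by positivity))
      _ = (4 * 5 ^ α)⁻¹ * p₀ x := by
          rw [mul_assoc, ← Real.rpow_add hpx, ← add_div,
            show G + 2 * α = E by rw [hG, hE]; ring, div_self hE0.ne', Real.rpow_one]
  have hcmp : ∀ x ∈ B, ∀ y ∈ Metric.closedBall x (5 * h x), p₀ x ≤ 4 * p₀ y ∧ p₀ y ≤ 2 * p₀ x := by
    intro x hx y hy
    refine comparable_of_mem_densityClass hc' hp ?_
    rw [mem_closedBall_iff_norm, norm_sub_rev] at hy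
    have hhx := hhB x hx
    calc L * ‖x - y‖ ^ α ≤ L * (5 * h x) ^ α := by gcongr
      _ = 5 ^ α * (L * h x ^ α) := by rw [Real.mul_rpow (by norm_num) hhx.le]; ring
      _ ≤ 5 ^ α * ((4 * 5 ^ α)⁻¹ * p₀ x) :=
          mul_le_mul_of_nonneg_left (hLhp x hx) (by positivity)
      _ = p₀ x / 4 := by
          have : (5 : ℝ) ^ α ≠ 0 := by positivity
          field_simp
  obtain ⟨M, hM⟩ := bddAbove_of_mem_densityClass hα hL hc' hp
  have hhR : ∀ x ∈ B, h x ≤ κ * M ^ (2 / E) := fun x hx =>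
    mul_le_mul_of_nonneg_left (Real.rpow_le_rpow (hpB x hx).le (hM x) (by positivity)) hκ0.le
  obtain ⟨s, hsB, hdisj, hIS⟩ := exists_finset_disjoint_closedBall (p := p₀) (h := h) hr0.le
    hp.2.2.1 hhB hhR (fun x hx y hy => (hcmp x hx y hy).2) hI0 hItop
  set S := ∑ x ∈ s, p₀ x ^ rExp d α t * h x ^ d with hS
  have hIS' : I ≤ W * S := by rw [hW]; exact hIS
  have hS0 : 0 < S := by
    by_contra hcon
    have : W * S ≤ 0 := mul_nonpos_of_nonneg_of_nonpos hW0.le (not_lt.1 hcon)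
    linarith
  -- shrinking the amplitudes by `b` compensates for a possible excess of `S` over the bulk integral
  set b := (I / (W * S)) ^ (1 / 4 : ℝ) with hb
  have hb0 : 0 < b := by positivity
  have hb1 : b ≤ 1 := Real.rpow_le_one (by positivity)
    (div_le_one_of_le₀ hIS' (by positivity)) (by norm_num)
  have hb4 : b ^ 4 * S = I / W := by
    have : b ^ 4 = I / (W * S) := by
      rw [hb, ← Real.rpow_natCast, ← Real.rpow_mul (by positivity)]
      norm_num
    rw [this]
    field_simp
  have h5 : (4 * (5 : ℝ) ^ α)⁻¹ ≤ 1 / 4 := by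
    rw [one_div]
    have : (1 : ℝ) ≤ 5 ^ α := Real.one_le_rpow (by norm_num) hα.le
    gcongr
    linarith
  have hθb : θ * b ≤ θ := mul_le_of_le_one_right hθ.le hb1
  have hself : ∀ i : s, ∀ y ∈ Metric.closedBall (i : Space d) (h i),
      y ∈ Metric.closedBall (i : Space d) (5 * h i) := fun i y hy =>
    Metric.closedBall_subset_closedBall (by linarith [hhB i (hsB i i.2)]) hy
  refine le_minimaxRisk_of_bumps (β := θ * b) (a := fun i : s => (i : Space d))
    (h := fun i : s => h i) hα hL ht.1 hc hc' hp hφ hs hφ1 hφ0 hq hw hv hK0 hK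
    (hθ.le.trans hθε) hε1 hεδ hεc (by positivity) ?_ (fun i => hhB i (hsB i i.2)) ?_
    (fun i => hpB i (hsB i i.2)) (fun i y hy => (hcmp i (hsB i i.2) y (hself i y hy)).1) ?_ hτ
    ?_ hρ0 ?_
  · refine le_trans ?_ hθK
    gcongr
  · intro i j hij
    exact hdisj i.2 j.2 fun hij' => hij (Subtype.ext hij')
  · intro i
    have hpi := hpB i (hsB i i.2)
    have h1 := hLhp i (hsB i i.2)
    calc θ * b * L * h i ^ α = θ * b * (L * h i ^ α) := by ring
      _ ≤ ε * (1 / 4 * p₀ i) := by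
          have h2 : L * h i ^ α ≤ 1 / 4 * p₀ i :=
            h1.trans (mul_le_mul_of_nonneg_right h5 hpi.le)
          have h3 : 0 ≤ L * h i ^ α := by have := hhB i (hsB i i.2); positivity
          exact mul_le_mul (hθb.trans hθε) h2 h3 (hθ.le.trans hθε)
      _ = ε / 4 * p₀ i := by ring
  · have hterm : ∀ x ∈ s, ((n : ℝ) * (4 * (θ * b * L * h x ^ α) ^ 2 / p₀ x * (h x ^ d * V))) ^ 2
        = 16 * V ^ 2 * θ ^ 4 * b ^ 4 * ((n : ℝ) ^ 2 * L ^ 4 * κ ^ (4 * α + d))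
          * (p₀ x ^ rExp d α t * h x ^ d) := by
      intro x hx
      have hpx := hpB x (hsB x hx)
      have hhx := hhB x (hsB x hx)
      have e1 : (h x ^ α) ^ 4 * h x ^ d = κ ^ (4 * α + d) * (p₀ x ^ 2 * p₀ x ^ rExp d α t) := by
        rw [← Real.rpow_natCast (h x ^ α) 4, ← Real.rpow_mul hhx.le, ← Real.rpow_natCast (h x) d,
          ← Real.rpow_add hhx, show α * ((4 : ℕ) : ℝ) + d = 4 * α + d by push_cast; ring]
        simp only [hh]
        rw [Real.mul_rpow hκ0.le (by positivity), ← Real.rpow_mul hpx.le,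
          ← Real.rpow_natCast (p₀ x) 2, ← Real.rpow_add hpx, hr]
        congr 2
        field_simp
        rw [hE]
        push_cast
        ring
      calc ((n : ℝ) * (4 * (θ * b * L * h x ^ α) ^ 2 / p₀ x * (h x ^ d * V))) ^ 2
          = 16 * V ^ 2 * θ ^ 4 * b ^ 4 * ((n : ℝ) ^ 2 * L ^ 4) * ((h x ^ α) ^ 4 * h x ^ d)
            * h x ^ d / p₀ x ^ 2 := by
            field_simp
            ring
        _ = _ := by
            rw [e1]
            field_simp
    have hsum : ∑ i : s, ((n : ℝ) * (4 * (θ * b * L * h i ^ α) ^ 2 / p₀ i * (h i ^ d * V))) ^ 2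
        = 16 * V ^ 2 * θ ^ 4 * κ₀ ^ (4 * α + d) / W := by
      rw [Finset.sum_coe_sort s
        (fun x => ((n : ℝ) * (4 * (θ * b * L * h x ^ α) ^ 2 / p₀ x * (h x ^ d * V))) ^ 2),
        Finset.sum_congr rfl hterm, ← Finset.mul_sum, ← hS, ← hκD]
      calc _ = 16 * V ^ 2 * θ ^ 4 * ((n : ℝ) ^ 2 * L ^ 4 * κ ^ (4 * α + d)) * (b ^ 4 * S) := by ring
        _ = _ := by rw [hb4]; ring
    rw [hsum]
    have h1 : 16 * V ^ 2 * θ ^ 4 * κ₀ ^ (4 * α + d) / W / 2 ≤ Real.log (1 + τ ^ 2) := by linarith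
    have h2 := Real.exp_le_exp.2 h1
    rw [Real.exp_log (by positivity)] at h2
    linarith
  · have hterm : ∀ x ∈ s, (θ * b * L * h x ^ α * q) ^ t * ((h x * w) ^ d * V)
        = (θ * q * (κ₀ ^ α * Q)) ^ t * (w ^ d * V) * b ^ t * (p₀ x ^ rExp d α t * h x ^ d) := by
      intro x hx
      have hpx := (hpB x (hsB x hx)).le
      rw [show θ * b * L * h x ^ α * q = θ * q * b * (L * h x ^ α) by ring, hLh x (hsB x hx),
        show θ * q * b * (κ₀ ^ α * Q * p₀ x ^ (2 * α / E))
          = θ * q * (κ₀ ^ α * Q) * b * p₀ x ^ (2 * α / E) by ring,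
        Real.mul_rpow (by positivity) (by positivity), Real.mul_rpow (by positivity) hb0.le,
        ← Real.rpow_mul hpx, hr, div_mul_eq_mul_div, mul_pow]
      ring
    rw [Finset.sum_coe_sort s (fun x => (θ * b * L * h x ^ α * q) ^ t * ((h x * w) ^ d * V)),
      Finset.sum_congr rfl hterm, ← Finset.mul_sum, ← hS]
    have hbt : b ^ 4 ≤ b ^ t := by
      rw [← Real.rpow_natCast]
      exact Real.rpow_le_rpow_of_exponent_ge hb0 hb1 (by push_cast; linarith [ht.2])
    calc ρ ^ t ≤ (θ * q * κ₀ ^ α * (w ^ d * V / W) ^ (1 / t) * (Q * I ^ (1 / t))) ^ t :=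
          Real.rpow_le_rpow hρ0 hρ ht0.le
      _ = (θ * q * (κ₀ ^ α * Q)) ^ t * (w ^ d * V) * (I / W) := by
          rw [show θ * q * κ₀ ^ α * (w ^ d * V / W) ^ (1 / t) * (Q * I ^ (1 / t))
              = θ * q * (κ₀ ^ α * Q) * ((w ^ d * V / W) ^ (1 / t) * I ^ (1 / t)) by ring,
            ← Real.mul_rpow (by positivity) hIpos.le,
            Real.mul_rpow (by positivity) (by positivity), ← Real.rpow_mul (by positivity),
            one_div_mul_cancel ht0.ne', Real.rpow_one]
          ring
      _ ≤ (θ * q * (κ₀ ^ α * Q)) ^ t * (w ^ d * V) * (b ^ t * S) := by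
          rw [← hb4]
          gcongr
      _ = _ := by ring

lemma rhoBulk_eq_bumpScale {d : ℕ} (hd : 1 ≤ d) {α L t cAux : ℝ} (hα : 0 < α) (hL : 0 < L)
    (ht : t ∈ Icc (1 : ℝ) 2) {n : ℕ} (hn : 1 ≤ n) {p : Space d → ℝ} (hp0 : ∀ x, 0 ≤ p x)
    (hpm : Measurable p) (hI0 : bulkIntegral α L t cAux n p ≠ 0)
    (hItop : bulkIntegral α L t cAux n p ≠ ⊤) :
    rhoBulk α L t cAux n p = ENNReal.ofReal
      (bumpScale d α L n (bulkIntegral α L t cAux n p).toReal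
        * (bulkIntegral α L t cAux n p).toReal ^ (1 / t)) := by
  have hd0 : (0 : ℝ) < d := by exact_mod_cast hd
  have hn0 : (0 : ℝ) < n := by exact_mod_cast hn
  have ht0 : 0 < t := by linarith [ht.1]
  have hLt : 0 < Ltilde d α L n := by unfold Ltilde; positivity
  set I := (bulkIntegral α L t cAux n p).toReal with hI
  have hIpos : 0 < I := ENNReal.toReal_pos hI0 hItop
  have hQ := bumpScale_pos (d := d) (α := α) hL hn hIpos
  rw [rhoBulk_eq hd hα ht hp0 hpm, ← ENNReal.ofReal_toReal hItop, ← hI,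
    ENNReal.ofReal_rpow_of_pos hIpos, ← ENNReal.ofReal_mul hLt.le,
    ENNReal.ofReal_rpow_of_pos (by positivity)]
  congr 1
  refine Real.log_injOn_pos (mem_Ioi.2 (by positivity)) (mem_Ioi.2 (by positivity)) ?_
  rw [Real.log_rpow (by positivity), Real.log_mul hLt.ne' (by positivity), Real.log_rpow hIpos,
    Real.log_mul hQ.ne' (by positivity), Real.log_rpow hIpos, log_bumpScale hL hn hIpos]
  field_simp
  ring

end HolderGoF

theorem mainTheorem3 (d : ℕ) (hd : 1 ≤ d) (α t η δ cstar cAux cB CBT : ℝ)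
    (hα : 0 < α) (ht : t ∈ Set.Icc (1 : ℝ) 2) (hη : η ∈ Set.Ioo (0 : ℝ) 1) (hδ : 0 < δ)
    (hcstar : cstar ∈ Set.Ioo (0 : ℝ) (1 / 2)) (hcAux : 0 < cAux) (hcB : 0 < cB)
    (hCBT : 0 < CBT) :
    ∃ C : ℝ, 0 < C ∧
      ∀ (L : ℝ) (n : ℕ) (p₀ : HolderGoF.Space d → ℝ), 0 < L → 1 ≤ n →
        p₀ ∈ HolderGoF.densityClass d α L cstar →
        HolderGoF.BulkDominates α L t cAux cB CBT n p₀ →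
        ENNReal.ofReal C * HolderGoF.rhoBulk α L t cAux n p₀ ≤
          HolderGoF.separationRadius α L cstar δ t η n p₀ := by
  open HolderGoF in
  obtain ⟨φ, hφ, hφc, hs, hφ1, hφ0, v, q, w, hq, hw, hv⟩ := exists_bump hd
  obtain ⟨K, hK0, hK⟩ := exists_taylorPoly_remainder_le hα hφ hφc
  obtain ⟨k, hk, hkey⟩ := exists_mul_bumpScale_le_uAux hd hα ht hcAux hcB hCBT
  obtain ⟨hc, hc'⟩ := hcstar
  have hd0 : (0 : ℝ) < d := by exact_mod_cast hd
  have ht0 : 0 < t := by linarith [ht.1]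
  have hE0 : 0 < (4 - t) * α + d := by nlinarith [ht.2]
  have hr0 : 0 < rExp d α t := by unfold rExp; positivity
  set V := (volume : Measure (Space d)).real (Metric.ball 0 1) with hV
  have hV0 : 0 < V := ENNReal.toReal_pos (Metric.measure_ball_pos _ _ one_pos).ne'
    measure_ball_lt_top.ne
  set W : ℝ := 2 * (2 ^ rExp d α t * 5 ^ d * V) with hW
  have hW0 : 0 < W := by positivity
  set τ := (1 - η) / 2 with hτ
  have hτ0 : 0 < τ := by have := hη.2; rw [hτ]; linarith
  -- the size `ε` of the perturbation relative to `p₀` that the larger class allows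
  set ε := min 1 (min δ (δ * cstar / (3 + (1 + δ) * cstar))) with hε
  have hε0 : 0 < ε := by positivity
  have hεc : cstar + 3 * ε ≤ (1 + δ) * cstar * (1 - ε) := by
    have h1 : ε ≤ δ * cstar / (3 + (1 + δ) * cstar) := (min_le_right _ _).trans (min_le_right _ _)
    rw [le_div_iff₀ (by positivity)] at h1
    linarith
  set κ₀ := ((4 * 5 ^ α)⁻¹ * k) ^ (1 / α) with hκ₀
  have hκ₀0 : 0 < κ₀ := by positivity
  have hκk : κ₀ ^ α ≤ (4 * 5 ^ α)⁻¹ * k := by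
    rw [hκ₀, ← Real.rpow_mul (by positivity), one_div_mul_cancel hα.ne', Real.rpow_one]
  have hlog : 0 < Real.log (1 + τ ^ 2) := Real.log_pos (by nlinarith)
  -- the factor `θ` meets the constraints of positivity, smoothness and indistinguishability
  set θ := min ε (min (δ / (2 * K))
    (2 * Real.log (1 + τ ^ 2) * W / (16 * V ^ 2 * κ₀ ^ (4 * α + d)))) with hθ
  have hθ0 : 0 < θ := by positivity
  have hθε : θ ≤ ε := min_le_left _ _
  have hθK : 2 * θ * K ≤ δ := by
    have h1 : θ ≤ δ / (2 * K) := (min_le_right _ _).trans (min_le_left _ _)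
    rw [le_div_iff₀ (by positivity)] at h1
    linarith
  have hθτ : 16 * V ^ 2 * θ ^ 4 * κ₀ ^ (4 * α + d) / W ≤ 2 * Real.log (1 + τ ^ 2) := by
    have h1 : θ ≤ 2 * Real.log (1 + τ ^ 2) * W / (16 * V ^ 2 * κ₀ ^ (4 * α + d)) :=
      (min_le_right _ _).trans (min_le_right _ _)
    have h2 : θ ^ 4 ≤ θ := pow_le_of_le_one hθ0.le (hθε.trans (min_le_left _ _)) (by norm_num)
    rw [div_le_iff₀ hW0]
    calc 16 * V ^ 2 * θ ^ 4 * κ₀ ^ (4 * α + d) ≤ 16 * V ^ 2 * θ * κ₀ ^ (4 * α + d) := by gcongr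
      _ = θ * (16 * V ^ 2 * κ₀ ^ (4 * α + d)) := by ring
      _ ≤ _ := (le_div_iff₀ (by positivity)).1 h1
  refine ⟨θ * q * κ₀ ^ α * (w ^ d * V / W) ^ (1 / t), by positivity, ?_⟩
  intro L n p₀ hL hn hp hBD
  have hpm := (continuous_of_mem_densityClass hα hp).measurable
  by_cases hI0 : bulkIntegral α L t cAux n p₀ = 0
  · rw [rhoBulk_eq hd hα ht hp.2.2.1 hpm, hI0, ENNReal.zero_rpow_of_pos (by positivity), mul_zero,
      ENNReal.zero_rpow_of_pos (by positivity), mul_zero]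
    exact zero_le
  · have hu : uAux α L cAux n p₀ ≠ ⊤ := by
      intro h
      rw [bulkIntegral, h, bulk_top, mass, Measure.restrict_empty, lintegral_zero_measure] at hI0
      exact hI0 rfl
    have hItop := bulkIntegral_ne_top hd hα hL hc' ht hcAux hn hp hu
    refine le_iInf₂ fun ρ hρ => ?_
    rw [rhoBulk_eq_bumpScale hd hα hL ht hn hp.2.2.1 hpm hI0 hItop,
      ← ENNReal.ofReal_mul (by positivity)]
    by_contra hcon
    have hρlt := (ENNReal.ofReal_lt_ofReal_iff_of_nonneg hρ.1.le).1 (not_le.1 hcon)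
    have hrisk := le_minimaxRisk_of_le_bumpScale hd (n := n) hα hL hn ht hc hc' hcAux hp hφ hs hφ1
      hφ0 hq hw hv hK0.le hK (min_le_left _ _) ((min_le_right _ _).trans (min_le_left _ _)) hεc hτ0
      hκ₀0 hκk hW hθ0 hθε hθK hθτ hu hI0 (hkey L cstar n p₀ hL hn hp hBD hu hI0 hItop)
      hρ.1.le hρlt.le
    have := (ENNReal.ofReal_le_ofReal_iff hη.1.le).1 (hrisk.trans hρ.2)
    rw [hτ] at this
    linarith [hη.2]
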